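/- Let $M$ be a smooth (Hausdorff, boundaryless) manifold of dimension $n$ with a smooth Riemannian metric $g$, let $\Omega^\bullet(M)$ be the differential graded algebra of smooth differential forms on $M$ and $\Omega^\bullet(M,TM)$ the graded $\Omega^\bullet(M)$-module of smooth $TM$-valued forms. Let $\nabla:\Omega^\bullet(M,TM)\to\Omega^{\bullet+1}(M,TM)$ be the (exterior) covariant derivative of the Levi-Civita connection of $g$. In local coordinates $x_1,\dots,x_n$ with $g_{ij}=g(\partial_i,\partial_j)$ and $(g^{ij})$ the inverse matrix, it is given by $\nabla\alpha=d\alpha+\omega\wedge\alpha$, where $\omega=\sum_k\omega_k\,dx_k$, $\omega_k(\partial_j)=\sum_i\Gamma^i_{jk}\partial_i$ and $$\Gamma^i_{jk}=\sum_l\tfrac12(\partial_k g_{lj}+\partial_j g_{lk}-\partial_l g_{jk})g^{il}.$$ Put $$R^i_{jkl}=\partial_k\Gamma^i_{jl}-\partial_l\Gamma^i_{jk}+\sum_h\bigl(\Gamma^h_{jl}\Gamma^i_{hk}-\Gamma^h_{jk}\Gamma^i_{hl}\bigr),$$ and let $R_{ab}$ be the $n\times n$ matrix with $(l,m)$ entry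 $R^l_{m\,ab}$, i.e. the matrix of the curvature endomorphism $R(\partial_a,\partial_b)$. For $N\ge1$, say that $(\Omega^\bullet(M,TM),\nabla)$ is an $N$-dga if $\nabla$ is a well-defined $\mathbb R$-linear operator of degree one satisfying the graded Leibniz rule $\nabla(a\wedge\alpha)=da\wedge\alpha+(-1)^{\deg a}a\wedge\nabla\alpha$ for $a\in\Omega^\bullet(M)$, $\alpha\in\Omega^\bullet(M,TM)$, and $\nabla^N=0$. For a set $A=\{s_1<\dots<s_{2k}\}\subseteq[n]=\{1,\dots,n\}$ let $P(A)$ be the set of ordered pairings of $A$, i.e. of sequences $\alpha=((a_i,b_i))_{i=1}^k$ with $a_i<b_i$ and $A=\bigsqcup_i\{a_i,b_i\}$, and let $\operatorname{sign}(\alpha)$ be the sign of the permutation taking $(s_1,\dots,s_{2k})$ to $(a_1,b_1,\dots,a_k,b_k)$. Theorem. Let $k\ge1$, and let any family of smooth charts covering $M$ be given. Then $(\Omega^\bullet(M,TM),\nabla)$ is a $2k$-dga if and only if, at every point of every chart of the family, $$\sum_{\alpha\in P(A)}\operatorname{sign}(\alpha)\,R_{a_1b_1}R_{a_2b_2}\cdots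 R_{a_kb_k}=0$$ (product of matrices; equivalently, every $(l,m)$ entry of this sum is zero) for all $A\subseteq[n]$ with cardinality $2k$. -/

import Mathlib

open scoped Manifold ContDiff

noncomputable section

namespace RiemannianForms

/-- The model space `ℝⁿ`. -/
abbrev Eucl (n : ℕ) : Type := EuclideanSpace ℝ (Fin n)

/-! ### Wedge product of a scalar-valued with a vector-valued alternating map -/

section Wedge

variable {V W : Type*} [AddCommGroup V] [Module ℝ V] [TopologicalSpace V]
  [AddCommGroup W] [Module ℝ W] [TopologicalSpace W] [IsTopologicalAddGroup W]
  [ContinuousSMul ℝ W]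

/-- The multilinear map `(v, w) ↦ a(v) • b(w)`. -/
def tensorMul {p q : ℕ} (a : V [⋀^Fin p]→L[ℝ] ℝ) (b : V [⋀^Fin q]→L[ℝ] W) :
    ContinuousMultilinearMap ℝ (fun _ : Fin p ⊕ Fin q => V) W where
  toFun v := a (fun i => v (Sum.inl i)) • b (fun j => v (Sum.inr j))
  map_update_add' := by
    intro _ v i x y
    rcases i with i | i
    · have hl := fun z : V => Function.update_comp_eq_of_injective v
        (Sum.inl_injective (α := Fin p) (β := Fin q)) i z
      have hr := fun z : V => Sum.update_inl_comp_inr (f := v) (i := i) (x := z)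
      simp only [Function.comp_def] at hl hr
      simp only [hl, hr, ContinuousAlternatingMap.map_update_add, add_smul]
    · have hl := fun z : V => Function.update_comp_eq_of_injective v
        (Sum.inr_injective (α := Fin p) (β := Fin q)) i z
      have hr := fun z : V => Sum.update_inr_comp_inl (f := v) (i := i) (x := z)
      simp only [Function.comp_def] at hl hr
      simp only [hl, hr, ContinuousAlternatingMap.map_update_add, smul_add]
  map_update_smul' := by
    intro _ v i c x
    rcases i with i | i
    · have hl := fun z : V => Function.update_comp_eq_of_injective v
        (Sum.inl_injective (α := Fin p) (β := Fin q)) i z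
      have hr := fun z : V => Sum.update_inl_comp_inr (f := v) (i := i) (x := z)
      simp only [Function.comp_def] at hl hr
      simp only [hl, hr, ContinuousAlternatingMap.map_update_smul, smul_assoc]
    · have hl := fun z : V => Function.update_comp_eq_of_injective v
        (Sum.inr_injective (α := Fin p) (β := Fin q)) i z
      have hr := fun z : V => Sum.update_inr_comp_inl (f := v) (i := i) (x := z)
      simp only [Function.comp_def] at hl hr
      simp only [hl, hr, ContinuousAlternatingMap.map_update_smul, smul_comm c]
  cont := by
    refine Continuous.smul ?_ ?_
    · exact a.cont.comp (continuous_pi fun i => continuous_apply _)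
    · exact b.cont.comp (continuous_pi fun i => continuous_apply _)

/-- The wedge product
`(a ∧ b)(v₁, …, v_{p+q}) = 1/(p! q!) ∑_σ sign(σ) a(v_{σ 1}, …, v_{σ p}) • b(v_{σ (p+1)}, …)`,
where `h : p + q = r` records the degree of the product. -/
def wedge {p q r : ℕ} (h : p + q = r) (a : V [⋀^Fin p]→L[ℝ] ℝ) (b : V [⋀^Fin q]→L[ℝ] W) :
    V [⋀^Fin r]→L[ℝ] W :=
  ((p.factorial : ℝ) * (q.factorial : ℝ))⁻¹ •
    ContinuousMultilinearMap.alternatization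
      ((tensorMul a b).domDomCongr (finSumFinEquiv.trans (finCongr h)))

end Wedge

/-! ### Differential forms on a manifold and their coordinate representations -/

section Forms

variable {n : ℕ} {M : Type*} [TopologicalSpace M] [ChartedSpace (Eucl n) M]

variable (n M) in
/-- Scalar-valued `p`-forms (not necessarily smooth): `α_x : (T_x M)^p → ℝ`. -/
abbrev ScalarForm (p : ℕ) : Type _ :=
  ∀ x : M, TangentSpace (𝓡 n) x [⋀^Fin p]→L[ℝ] ℝ

variable (n M) in
/-- `TM`-valued `p`-forms (not necessarily smooth): `α_x : (T_x M)^p → T_x M`. -/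
abbrev TangentForm (p : ℕ) : Type _ :=
  ∀ x : M, TangentSpace (𝓡 n) x [⋀^Fin p]→L[ℝ] TangentSpace (𝓡 n) x

/-- The differential `T_x M → ℝⁿ` of a chart `e`. -/
def chartDeriv (e : OpenPartialHomeomorph M (Eucl n)) (x : M) :
    TangentSpace (𝓡 n) x →L[ℝ] Eucl n :=
  mfderiv (𝓡 n) (𝓡 n) e x

/-- The inverse `ℝⁿ → T_x M` of the differential of a chart; it sends the `i`-th standard basis
vector to the coordinate vector `∂ᵢ` at `x`. -/
def chartFrame (e : OpenPartialHomeomorph M (Eucl n)) (x : M) :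
    Eucl n →L[ℝ] TangentSpace (𝓡 n) x :=
  (chartDeriv e x).inverse

/-- A scalar form in the coordinates of the chart `e`. -/
def ScalarForm.inChart {p : ℕ} (e : OpenPartialHomeomorph M (Eucl n)) (a : ScalarForm n M p)
    (y : Eucl n) : Eucl n [⋀^Fin p]→L[ℝ] ℝ :=
  (a (e.symm y)).compContinuousLinearMap (chartFrame e (e.symm y))

/-- A `TM`-valued form in the coordinates of the chart `e`. -/
def TangentForm.inChart {p : ℕ} (e : OpenPartialHomeomorph M (Eucl n)) (α : TangentForm n M p)
    (y : Eucl n) : Eucl n [⋀^Fin p]→L[ℝ] Eucl n :=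
  (chartDeriv e (e.symm y)).compContinuousAlternatingMap
    ((α (e.symm y)).compContinuousLinearMap (chartFrame e (e.symm y)))

/-- Smoothness of a scalar form: it is smooth in every smooth chart. -/
def ScalarForm.IsSmooth {p : ℕ} (a : ScalarForm n M p) : Prop :=
  ∀ e ∈ IsManifold.maximalAtlas (𝓡 n) ∞ M, ContDiffOn ℝ ∞ (a.inChart e) e.target

/-- Smoothness of a `TM`-valued form: it is smooth in every smooth chart. -/
def TangentForm.IsSmooth {p : ℕ} (α : TangentForm n M p) : Prop :=
  ∀ e ∈ IsManifold.maximalAtlas (𝓡 n) ∞ M, ContDiffOn ℝ ∞ (α.inChart e) e.target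

/-- The de Rham differential, computed at each point `x` in the preferred chart at `x`. -/
def ScalarForm.d {p : ℕ} (a : ScalarForm n M p) : ScalarForm n M (p + 1) := fun x =>
  (extDeriv (a.inChart (chartAt (Eucl n) x)) (chartAt (Eucl n) x x)).compContinuousLinearMap
    (chartDeriv (chartAt (Eucl n) x) x)

/-- The pointwise product `Ω^p(M) × Ω^q(M, TM) → Ω^{p+q}(M, TM)`. -/
def ScalarForm.wedge {p q r : ℕ} (h : p + q = r) (a : ScalarForm n M p) (α : TangentForm n M q) :
    TangentForm n M r :=
  fun x => RiemannianForms.wedge h (a x) (α x)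

/-- The iterates `D^N : Ω^p(M, TM) → Ω^{p+N}(M, TM)` of a degree one operator. -/
def iter (D : ∀ p : ℕ, TangentForm n M p → TangentForm n M (p + 1)) {p : ℕ} :
    ∀ N : ℕ, TangentForm n M p → TangentForm n M (p + N)
  | 0, α => α
  | N + 1, α => D (p + N) (iter D N α)

/-- `(Ω^•(M, TM), D)` is an `N`-differential graded object over the differential graded algebra
`(Ω^•(M), ∧, d)`: `D` is a well-defined `ℝ`-linear operator of degree one on smooth `TM`-valued
forms, it satisfies the graded Leibniz rule `D(a ∧ α) = da ∧ α + (-1)^{deg a} a ∧ Dα`, and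
`D^N = 0`. -/
structure IsNDG (N : ℕ) (D : ∀ p : ℕ, TangentForm n M p → TangentForm n M (p + 1)) : Prop where
  smooth : ∀ (p : ℕ) (α : TangentForm n M p), α.IsSmooth → (D p α).IsSmooth
  add : ∀ (p : ℕ) (α β : TangentForm n M p), α.IsSmooth → β.IsSmooth →
    D p (α + β) = D p α + D p β
  smul : ∀ (p : ℕ) (c : ℝ) (α : TangentForm n M p), α.IsSmooth → D p (c • α) = c • D p α
  leibniz : ∀ (p q r : ℕ) (h : p + q = r) (a : ScalarForm n M p) (α : TangentForm n M q),
    a.IsSmooth → α.IsSmooth →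
      D r (a.wedge h α) =
        a.d.wedge (show (p + 1) + q = r + 1 by omega) α +
          (-1 : ℝ) ^ p • a.wedge (show p + (q + 1) = r + 1 by omega) (D q α)
  nilpotent : ∀ (p : ℕ) (α : TangentForm n M p), α.IsSmooth → iter D N α = 0

end Forms

/-! ### The Levi-Civita connection and its curvature -/

section LeviCivita

variable {n : ℕ} {M : Type*} [TopologicalSpace M] [ChartedSpace (Eucl n) M]
  [IsManifold (𝓡 n) ∞ M]

variable (n M) in
/-- A smooth Riemannian metric on `M`. -/
abbrev Metric : Type _ :=
  Bundle.ContMDiffRiemannianMetric (𝓡 n) ∞ (Eucl n) (fun x : M => TangentSpace (𝓡 n) x)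

/-- The partial derivative `∂f/∂xₖ`. -/
def pderiv (k : Fin n) (f : Eucl n → ℝ) (y : Eucl n) : ℝ :=
  fderiv ℝ f y (EuclideanSpace.single k 1)

/-- The matrix `g_{ij} = g(∂ᵢ, ∂ⱼ)` of the metric in the coordinates of the chart `e`. -/
def gram (g : Metric n M) (e : OpenPartialHomeomorph M (Eucl n)) (y : Eucl n) :
    Matrix (Fin n) (Fin n) ℝ :=
  Matrix.of fun i j => g.inner (e.symm y)
    (chartFrame e (e.symm y) (EuclideanSpace.single i 1))
    (chartFrame e (e.symm y) (EuclideanSpace.single j 1))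

/-- The Christoffel symbol
`Γⁱ_{jk} = ∑_l ½ (∂ₖ g_{lj} + ∂ⱼ g_{lk} - ∂_l g_{jk}) g^{il}`. -/
def christoffel (g : Metric n M) (e : OpenPartialHomeomorph M (Eucl n)) (i j k : Fin n)
    (y : Eucl n) : ℝ :=
  ∑ l, 1 / 2 * (pderiv k (fun z => gram g e z l j) y + pderiv j (fun z => gram g e z l k) y
    - pderiv l (fun z => gram g e z j k) y) * (gram g e y)⁻¹ i l

/-- The component
`Rⁱ_{jkl} = ∂ₖ Γⁱ_{jl} - ∂_l Γⁱ_{jk} + ∑_h (Γʰ_{jl} Γⁱ_{hk} - Γʰ_{jk} Γⁱ_{hl})` of the Riemann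
curvature; `k`, `l` are the form indices and `i`, `j` the endomorphism indices. -/
def riemann (g : Metric n M) (e : OpenPartialHomeomorph M (Eucl n)) (i j k l : Fin n)
    (y : Eucl n) : ℝ :=
  pderiv k (christoffel g e i j l) y - pderiv l (christoffel g e i j k) y
    + ∑ h, (christoffel g e h j l y * christoffel g e i h k y
      - christoffel g e h j k y * christoffel g e i h l y)

/-- The endomorphism `R_{ab} = R(∂_a, ∂_b)`, as the matrix with entries `(l, m) ↦ R^l_{m a b}`. -/
def curvatureMatrix (g : Metric n M) (e : OpenPartialHomeomorph M (Eucl n)) (a b : Fin n)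
    (y : Eucl n) : Matrix (Fin n) (Fin n) ℝ :=
  Matrix.of fun l m => riemann g e l m a b y

/-- The coefficient `ω_k = ∇_{∂ₖ}` of the connection one-form `ω = ∑ₖ ω_k dxₖ`: the endomorphism
`∂ⱼ ↦ ∑ᵢ Γⁱ_{jk} ∂ᵢ`. -/
def connectionMatrix (g : Metric n M) (e : OpenPartialHomeomorph M (Eucl n)) (k : Fin n)
    (y : Eucl n) : Eucl n →L[ℝ] Eucl n :=
  ∑ i, ∑ j, christoffel g e i j k y •
    (EuclideanSpace.proj j : Eucl n →L[ℝ] ℝ).smulRight (EuclideanSpace.single i (1 : ℝ))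

/-- The expression `∇α = dα + ω ∧ α` in the coordinates of the chart `e`, where
`(ω ∧ α)(v₀, …, v_p) = ∑ₛ (-1)ˢ ω(vₛ) α(v₀, …, v̂ₛ, …, v_p)`. -/
def covDerivLocal (g : Metric n M) (e : OpenPartialHomeomorph M (Eucl n)) {p : ℕ}
    (α : Eucl n → Eucl n [⋀^Fin p]→L[ℝ] Eucl n) (y : Eucl n) :
    Eucl n [⋀^Fin (p + 1)]→L[ℝ] Eucl n :=
  extDeriv α y + ContinuousAlternatingMap.alternatizeUncurryFin
    (∑ k, (EuclideanSpace.proj k : Eucl n →L[ℝ] ℝ).smulRight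
      ((connectionMatrix g e k y).compContinuousAlternatingMap (α y)))

/-- The exterior covariant derivative `∇ : Ω^p(M, TM) → Ω^{p+1}(M, TM)` of the Levi-Civita
connection of `g`, computed at each point `x` in the preferred chart at `x`. -/
def covDeriv (g : Metric n M) (p : ℕ) (α : TangentForm n M p) : TangentForm n M (p + 1) :=
  fun x => (chartFrame (chartAt (Eucl n) x) x).compContinuousAlternatingMap
    ((covDerivLocal g (chartAt (Eucl n) x) (α.inChart (chartAt (Eucl n) x))
      (chartAt (Eucl n) x x)).compContinuousLinearMap (chartDeriv (chartAt (Eucl n) x) x))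

end LeviCivita

/-! ### Ordered pairings -/

/-- Ordered pairings of `{s₀ < … < s_{2k-1}}`: the sequence of pairs `(aᵢ, bᵢ)`, `i < k`, with
`aᵢ < bᵢ` is recorded by the permutation `σ` for which
`(a₀, b₀, a₁, b₁, …) = (s_{σ 0}, s_{σ 1}, s_{σ 2}, s_{σ 3}, …)`; its sign is the sign of `σ`. -/
def orderedPairings (k : ℕ) : Finset (Equiv.Perm (Fin (2 * k))) :=
  {σ | ∀ i : Fin k, σ ⟨2 * i, by omega⟩ < σ ⟨2 * i + 1, by omega⟩}

/-- `∑_{α ∈ P(A)} sign(α) F_{a₁ b₁} F_{a₂ b₂} ⋯ F_{a_k b_k}` for a family of matrices `F`. -/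
def pairingSum {n k : ℕ} (F : Fin n → Fin n → Matrix (Fin n) (Fin n) ℝ) (A : Finset (Fin n))
    (hA : A.card = 2 * k) : Matrix (Fin n) (Fin n) ℝ :=
  ∑ σ ∈ orderedPairings k, ((Equiv.Perm.sign σ : ℤ) : ℝ) •
    (List.ofFn fun i : Fin k =>
      F (A.orderEmbOfFin hA (σ ⟨2 * i, by omega⟩))
        (A.orderEmbOfFin hA (σ ⟨2 * i + 1, by omega⟩))).prod

end RiemannianForms

end

/-!
In a chart, `∇` is `d + ω ∧ ·`. Differentiating once more, the second derivatives cancel by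
symmetry and what is left of `∇²` is of order zero: it is the action of the curvature
`Ω = dω + ω ∧ ω` (`covD_covD`). Hence `∇^{2k}` acts as `Ω^k` (`covIter_two_mul`):
`∇^{2k} α (v₀, …, v_{p+2k-1})` is, up to a nonzero factor, the signed sum over all permutations of
the arguments of `Ω(v₀, v₁) ⋯ Ω(v_{2k-2}, v_{2k-1}) α(v_{2k}, …)`. This depends on the value of `α`
at the point only, and it vanishes for all `α` if and only if the signed sum of
`Ω(v₀, v₁) ⋯ Ω(v_{2k-2}, v_{2k-1})` vanishes as an endomorphism: in one direction one sums first
over the permutations of the first `2k` arguments (`antisymm_curvPow_eq_zero`), in the other one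
takes for `α` vector fields with a prescribed value at the point, which bump functions provide
(`exists_isSmooth_inChart_eq`). The signed sum is alternating and multilinear in the `v i`, so that
it suffices to evaluate it at the coordinate vectors `∂_s`, `s` running through the members of a
`2k`-element set `A` in increasing order. There `Ω(∂_a, ∂_b) = R_{ab}` (`curv_connForm`), and since
`R_{ab} = -R_{ba}`, exchanging the members of each of the `k` pairs shows that the sum over all
permutations is `2 ^ k` times the sum over the ordered pairings of `A`
(`antisymm_pairProd_eq_pairingSum`).

The other requirements on `∇` hold for every metric. The Leibniz rule is a computation in a chart
(`covD_wedge`). That the local expressions agree on overlaps, so that `∇` preserves smoothness and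
can be computed in any chart (`inChart_covDeriv`), amounts to the transformation law of the
Christoffel symbols (`connForm_transition`). It is deduced from the Koszul formula (`koszul`),
which expresses the connection form through the derivative of the metric, by differentiating the
transformation law of the metric.

Identities between alternating maps are reduced throughout to the operator `antisymm` on arbitrary
functions of several arguments and to one property of it: antisymmetrizing a block of arguments
first only contributes a factorial (`antisymm_antisymm_block`).
-/

open scoped Manifold ContDiff

noncomputable section

namespace RiemannianForms

/-! ### Antisymmetrization of functions -/

section Antisymmetrization

open Equiv

variable {ι κ X W W' : Type*} [Fintype ι] [DecidableEq ι] [Fintype κ] [DecidableEq κ]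
  [AddCommGroup W] [AddCommGroup W']

/-- The signed sum `∑_σ sign(σ) f(v ∘ σ)` over all permutations, for an arbitrary function `f` of
`ι`-indexed families. No multilinearity is required, so that the index bookkeeping of iterated
wedge products can be done without constructing intermediate multilinear maps. -/
def antisymm (f : (ι → X) → W) (v : ι → X) : W :=
  ∑ σ : Perm ι, Perm.sign σ • f (v ∘ σ)

theorem antisymm_comp_perm (f : (ι → X) → W) (τ : Perm ι) (v : ι → X) :
    antisymm (fun w => f (w ∘ τ)) v = Perm.sign τ • antisymm f v := by
  simp only [antisymm, Finset.smul_sum, smul_smul]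
  refine Fintype.sum_equiv (Equiv.mulRight τ) _ _ fun σ => ?_
  simp only [Equiv.coe_mulRight, Perm.sign_mul, Perm.coe_mul, Function.comp_assoc]
  rw [mul_comm (Perm.sign σ), ← mul_assoc, Int.units_mul_self, one_mul]

theorem antisymm_apply_comp (f : (ι → X) → W) (τ : Perm ι) (v : ι → X) :
    antisymm f (v ∘ τ) = Perm.sign τ • antisymm f v := by
  simp only [antisymm, Finset.smul_sum, smul_smul]
  refine Fintype.sum_equiv (Equiv.mulLeft τ) _ _ fun σ => ?_
  simp only [Equiv.coe_mulLeft, Perm.sign_mul, Perm.coe_mul, Function.comp_assoc]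
  rw [← mul_assoc, Int.units_mul_self, one_mul]

theorem antisymm_add (f f' : (ι → X) → W) (v : ι → X) :
    antisymm (fun w => f w + f' w) v = antisymm f v + antisymm f' v := by
  simp [antisymm, Finset.sum_add_distrib]

theorem antisymm_sum {J : Type*} (s : Finset J) (f : J → (ι → X) → W) (v : ι → X) :
    antisymm (fun w => ∑ j ∈ s, f j w) v = ∑ j ∈ s, antisymm (f j) v := by
  simp only [antisymm, Finset.smul_sum]
  exact Finset.sum_comm

theorem antisymm_map (φ : W →+ W') (f : (ι → X) → W) (v : ι → X) :
    antisymm (fun w => φ (f w)) v = φ (antisymm f v) := by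
  simp only [antisymm, map_sum]
  refine Finset.sum_congr rfl fun σ _ => ?_
  rcases Int.units_eq_one_or (Perm.sign σ) with h | h <;> simp [h]

theorem antisymm_units_smul (s : ℤˣ) (f : (ι → X) → W) (v : ι → X) :
    antisymm (fun w => s • f w) v = s • antisymm f v := by
  simp only [antisymm, Finset.smul_sum, smul_smul, mul_comm]

theorem antisymm_smul [Module ℝ W] (c : ℝ) (f : (ι → X) → W) (v : ι → X) :
    antisymm (fun w => c • f w) v = c • antisymm f v :=
  antisymm_map (DistribSMul.toAddMonoidHom W c) f v

theorem antisymm_precomp {Y : Type*} (f : (ι → Y) → W) (T : X → Y) (v : ι → X) :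
    antisymm (fun w => f (T ∘ w)) v = antisymm f (T ∘ v) := rfl

/-- Antisymmetrizing in a block of arguments, given by the embedding `e`, before antisymmetrizing
in all of them only multiplies the result by the factorial of the size of the block. -/
theorem antisymm_antisymm_block (e : κ ↪ ι) (F : (ι → X) → (κ → X) → W)
    (hF : ∀ v v' : ι → X, (∀ i, i ∉ Set.range e → v i = v' i) → F v = F v') (v : ι → X) :
    antisymm (fun w => antisymm (F w) (w ∘ e)) v =
      (Fintype.card κ).factorial • antisymm (fun w => F w (w ∘ e)) v := by
  classical
  have key : ∀ w : ι → X, antisymm (F w) (w ∘ e) = ∑ τ : Perm κ, Perm.sign τ •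
      (fun u => F u (u ∘ e)) (w ∘ τ.viaFintypeEmbedding e) := by
    intro w
    refine Finset.sum_congr rfl fun τ _ => ?_
    congr 1
    have h1 : F (w ∘ τ.viaFintypeEmbedding e) = F w := by
      refine hF _ _ fun i hi => ?_
      simp only [Function.comp_apply]
      rw [Perm.viaFintypeEmbedding_apply_notMem_range _ _ hi]
    have h2 : (w ∘ τ.viaFintypeEmbedding e) ∘ e = (w ∘ e) ∘ τ := by
      funext i
      simp only [Function.comp_apply]
      rw [Perm.viaFintypeEmbedding_apply_image]
    simp only [h1, h2]
  simp only [key]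
  rw [antisymm_sum]
  simp only [antisymm_units_smul]
  have : ∀ τ : Perm κ, Perm.sign τ • antisymm
      (fun w => (fun u => F u (u ∘ e)) (w ∘ τ.viaFintypeEmbedding e)) v =
      antisymm (fun u => F u (u ∘ e)) v := by
    intro τ
    rw [antisymm_comp_perm (fun u => F u (u ∘ e)), Perm.viaFintypeEmbedding_sign, smul_smul,
      Int.units_mul_self, one_smul]
  rw [Finset.sum_congr rfl fun τ _ => this τ]
  simp [Fintype.card_perm]

theorem antisymm_eq_factorial_smul (f : (ι → X) → W)
    (hf : ∀ (τ : Perm ι) v, f (v ∘ τ) = Perm.sign τ • f v) (v : ι → X) :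
    antisymm f v = (Fintype.card ι).factorial • f v := by
  simp only [antisymm, hf, smul_smul, Int.units_mul_self, one_smul]
  simp [Fintype.card_perm]

end Antisymmetrization

section AlternatingMaps

open Equiv

variable {V W : Type*} [NormedAddCommGroup V] [NormedSpace ℝ V] [NormedAddCommGroup W]
  [NormedSpace ℝ W]

/-- Grouping the permutations by the position of the first argument: both sides sum over the
permutations, the right one in the form `∑ᵢ (-1)ⁱ f (v i) (v with i removed)`, in which `f` is
already alternating. -/
theorem antisymm_cons {p : ℕ} (f : V →L[ℝ] V [⋀^Fin p]→L[ℝ] W) (v : Fin (p + 1) → V) :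
    antisymm (fun w => f (w 0) (Fin.tail w)) v =
      (p.factorial : ℝ) • ContinuousAlternatingMap.alternatizeUncurryFin f v := by
  -- `f` is alternating in the last `p` arguments only, so the factor `p!` is found by comparing two
  -- evaluations of the antisymmetrization of the alternating map on the right
  have h1 := antisymm_eq_factorial_smul
    (fun w => ContinuousAlternatingMap.alternatizeUncurryFin f w)
    (fun τ w => (ContinuousAlternatingMap.alternatizeUncurryFin f).toAlternatingMap.map_perm w τ) v
  have h2 : antisymm (fun w => ContinuousAlternatingMap.alternatizeUncurryFin f w) v =
      (p + 1) • antisymm (fun w => f (w 0) (Fin.tail w)) v := by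
    have : ∀ w : Fin (p + 1) → V, ContinuousAlternatingMap.alternatizeUncurryFin f w =
        ∑ i : Fin (p + 1), Perm.sign i.cycleRange •
          (fun w => f (w 0) (Fin.tail w)) (w ∘ i.cycleRange.symm) := by
      intro w
      rw [ContinuousAlternatingMap.alternatizeUncurryFin_apply]
      refine Finset.sum_congr rfl fun i _ => ?_
      have ht : Fin.tail (w ∘ i.cycleRange.symm) = i.removeNth w := by
        funext j
        simp [Fin.tail, Fin.removeNth, Fin.cycleRange_symm_succ]
      simp only [ht, Function.comp_apply, Fin.cycleRange_symm_zero, Fin.sign_cycleRange]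
      rcases Nat.even_or_odd (i : ℕ) with h | h <;> simp [h.neg_one_pow]
    simp only [this]
    rw [antisymm_sum]
    simp only [antisymm_units_smul]
    have h3 : ∀ i : Fin (p + 1), Perm.sign i.cycleRange • antisymm
        (fun w : Fin (p + 1) → V => f ((w ∘ i.cycleRange.symm) 0)
          (Fin.tail (w ∘ i.cycleRange.symm))) v =
        antisymm (fun w => f (w 0) (Fin.tail w)) v := by
      intro i
      rw [antisymm_comp_perm (fun w => f (w 0) (Fin.tail w)) i.cycleRange.symm, Perm.sign_symm,
        smul_smul, Int.units_mul_self, one_smul]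
    rw [Finset.sum_congr rfl fun i _ => h3 i]
    simp
  rw [h2, Fintype.card_fin, Nat.factorial_succ, mul_smul] at h1
  simp only [← Nat.cast_smul_eq_nsmul ℝ] at h1
  exact smul_right_injective W (r := ((p + 1 : ℕ) : ℝ)) (by positivity) h1

theorem alternatizeUncurryFin_eq_antisymm {p : ℕ} (f : V →L[ℝ] V [⋀^Fin p]→L[ℝ] W)
    (v : Fin (p + 1) → V) :
    ContinuousAlternatingMap.alternatizeUncurryFin f v =
      (p.factorial : ℝ)⁻¹ • antisymm (fun w => f (w 0) (Fin.tail w)) v := by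
  rw [antisymm_cons, smul_smul, inv_mul_cancel₀ (by positivity), one_smul]

theorem wedge_apply {p q r : ℕ} (h : p + q = r) (a : V [⋀^Fin p]→L[ℝ] ℝ)
    (b : V [⋀^Fin q]→L[ℝ] W) (v : Fin r → V) :
    wedge h a b v = ((p.factorial : ℝ) * (q.factorial : ℝ))⁻¹ •
      antisymm (fun w => a (fun i => w (Fin.cast h (Fin.castAdd q i))) •
        b (fun j => w (Fin.cast h (Fin.natAdd p j)))) v := by
  rw [wedge, ContinuousAlternatingMap.smul_apply,
    ContinuousMultilinearMap.alternatization_apply_apply]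
  rfl

end AlternatingMaps

/-! ### Wedge products and the alternatization of one additional argument -/

section WedgeUncurry

variable {V W : Type*} [NormedAddCommGroup V] [NormedSpace ℝ V] [NormedAddCommGroup W]
  [NormedSpace ℝ W]

/-- Both sides are the same multiple of the antisymmetrization of
`A (w 0) (w 1, …, w p) • b (w (p + 1), …)`. -/
theorem alternatizeUncurryFin_wedge_left {p q r : ℕ} (h : p + q = r) (h' : p + 1 + q = r + 1)
    (A : V →L[ℝ] V [⋀^Fin p]→L[ℝ] ℝ) (b : V [⋀^Fin q]→L[ℝ] W) (F : V →L[ℝ] V [⋀^Fin r]→L[ℝ] W)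
    (hF : ∀ u, F u = wedge h (A u) b) :
    ContinuousAlternatingMap.alternatizeUncurryFin F =
      wedge h' (ContinuousAlternatingMap.alternatizeUncurryFin A) b := by
  subst h
  ext v
  have hl := antisymm_antisymm_block (W := W) (Fin.succEmb (p + q))
    (fun (w : Fin (p + q + 1) → V) u => A (w 0) (fun i => u (Fin.castAdd q i)) •
      b (fun j => u (Fin.natAdd p j)))
    (fun w w' hw => by
      have : w 0 = w' 0 := hw 0 (by simp)
      simp only [this]) v
  have hr := antisymm_antisymm_block (W := W)
    ((Fin.castAddEmb q).trans (finCongr h').toEmbedding)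
    (fun (w : Fin (p + q + 1) → V) (u : Fin (p + 1) → V) => A (u 0) (Fin.tail u) •
      b (fun j => w (Fin.cast h' (Fin.natAdd (p + 1) j))))
    (fun w w' hw => by
      have : ∀ j, w (Fin.cast h' (Fin.natAdd (p + 1) j)) =
          w' (Fin.cast h' (Fin.natAdd (p + 1) j)) := fun j => hw _ (by
        rintro ⟨i, hi⟩
        have := congrArg Fin.val hi
        simp at this
        omega)
      simp only [this]) v
  have hlr : (fun w : Fin (p + q + 1) → V =>
      A (w 0) (fun i => (w ∘ Fin.succEmb (p + q)) (Fin.castAdd q i)) •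
        b (fun j => (w ∘ Fin.succEmb (p + q)) (Fin.natAdd p j))) =
      fun w => A ((w ∘ (Fin.castAddEmb q).trans (finCongr h').toEmbedding) 0)
        (Fin.tail (w ∘ (Fin.castAddEmb q).trans (finCongr h').toEmbedding)) •
          b (fun j => w (Fin.cast h' (Fin.natAdd (p + 1) j))) := by
    funext w
    congr 2
    refine funext fun j => congrArg w (Fin.ext ?_)
    simp
    omega
  have e1 : ContinuousAlternatingMap.alternatizeUncurryFin F v =
      ((p + q).factorial : ℝ)⁻¹ • ((p.factorial : ℝ) * (q.factorial : ℝ))⁻¹ •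
        antisymm (fun w => antisymm (fun u => A (w 0) (fun i => u (Fin.castAdd q i)) •
          b (fun j => u (Fin.natAdd p j))) (w ∘ Fin.succEmb (p + q))) v := by
    rw [alternatizeUncurryFin_eq_antisymm]
    simp only [hF, wedge_apply, antisymm_smul]
    rfl
  have e2 : wedge h' (ContinuousAlternatingMap.alternatizeUncurryFin A) b v =
      (((p + 1).factorial : ℝ) * (q.factorial : ℝ))⁻¹ • ((p.factorial : ℝ))⁻¹ •
        antisymm (fun w => antisymm (fun u : Fin (p + 1) → V => A (u 0) (Fin.tail u) •
          b (fun j => w (Fin.cast h' (Fin.natAdd (p + 1) j))))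
            (w ∘ (Fin.castAddEmb q).trans (finCongr h').toEmbedding)) v := by
    rw [wedge_apply, ← antisymm_smul ((_ : ℝ)⁻¹) (fun w => antisymm _ _)]
    congr 1
    refine congrArg (antisymm · v) (funext fun w => ?_)
    rw [alternatizeUncurryFin_eq_antisymm, smul_assoc]
    congr 1
    exact (antisymm_map ((AddMonoidHom.flip (smulAddHom ℝ W))
      (b fun j => w (Fin.cast h' (Fin.natAdd (p + 1) j)))) _ _).symm
  rw [e1, e2, hl, hr, hlr]
  simp only [Fintype.card_fin, ← Nat.cast_smul_eq_nsmul ℝ, smul_smul]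
  congr 1
  have := Nat.factorial_pos (p + q)
  have := Nat.factorial_pos (p + 1)
  field_simp

/-- Both sides are multiples of the antisymmetrization of
`a (w 1, …, w p) • B (w 0) (w (p + 1), …)`; the sign `(-1) ^ p` comes from moving the argument of
`B` past those of `a`. -/
theorem alternatizeUncurryFin_wedge_right {p q r : ℕ} (h : p + q = r) (h' : p + (q + 1) = r + 1)
    (a : V [⋀^Fin p]→L[ℝ] ℝ) (B : V →L[ℝ] V [⋀^Fin q]→L[ℝ] W) (F : V →L[ℝ] V [⋀^Fin r]→L[ℝ] W)
    (hF : ∀ u, F u = wedge h a (B u)) :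
    ContinuousAlternatingMap.alternatizeUncurryFin F =
      (-1 : ℝ) ^ p • wedge h' a (ContinuousAlternatingMap.alternatizeUncurryFin B) := by
  subst h
  ext v
  have hl := antisymm_antisymm_block (W := W) (Fin.succEmb (p + q))
    (fun (w : Fin (p + q + 1) → V) u => a (fun i => u (Fin.castAdd q i)) •
      B (w 0) (fun j => u (Fin.natAdd p j)))
    (fun w w' hw => by
      have : w 0 = w' 0 := hw 0 (by simp)
      simp only [this]) v
  have hr := antisymm_antisymm_block (W := W)
    ((Fin.natAddEmb p).trans (finCongr h').toEmbedding)
    (fun (w : Fin (p + q + 1) → V) (u : Fin (q + 1) → V) =>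
      a (fun i => w (Fin.cast h' (Fin.castAdd (q + 1) i))) • B (u 0) (Fin.tail u))
    (fun w w' hw => by
      have : ∀ j, w (Fin.cast h' (Fin.castAdd (q + 1) j)) =
          w' (Fin.cast h' (Fin.castAdd (q + 1) j)) := fun j => hw _ (by
        rintro ⟨i, hi⟩
        have := congrArg Fin.val hi
        simp at this
        omega)
      simp only [this]) v
  -- the cycle that moves the argument in position `p` to the front
  let i₀ : Fin (p + q + 1) := ⟨p, by omega⟩
  have hlr : (fun w : Fin (p + q + 1) → V =>
      a (fun i => w (Fin.cast h' (Fin.castAdd (q + 1) i))) •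
        B ((w ∘ (Fin.natAddEmb p).trans (finCongr h').toEmbedding) 0)
          (Fin.tail (w ∘ (Fin.natAddEmb p).trans (finCongr h').toEmbedding))) =
      fun w => a (fun i => ((w ∘ i₀.cycleRange.symm) ∘ Fin.succEmb (p + q)) (Fin.castAdd q i)) •
        B ((w ∘ i₀.cycleRange.symm) 0)
          (fun j => ((w ∘ i₀.cycleRange.symm) ∘ Fin.succEmb (p + q)) (Fin.natAdd p j)) := by
    funext w
    simp only [Function.comp_apply, Fin.coe_succEmb, Fin.cycleRange_symm_succ,
      Fin.cycleRange_symm_zero]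
    congr 1
    · refine congrArg a (funext fun i => congrArg w (Fin.ext ?_))
      rw [Fin.succAbove_of_castSucc_lt _ _ (by simp [Fin.lt_def, i₀])]
      simp
    · congr 2
      refine funext fun j => congrArg w (Fin.ext ?_)
      rw [Fin.succAbove_of_le_castSucc _ _ (by simp [Fin.le_def, i₀])]
      simp
      omega
  have hc := antisymm_comp_perm (fun w : Fin (p + q + 1) → V =>
    a (fun i => (w ∘ Fin.succEmb (p + q)) (Fin.castAdd q i)) •
      B (w 0) (fun j => (w ∘ Fin.succEmb (p + q)) (Fin.natAdd p j))) i₀.cycleRange.symm v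
  have e1 : ContinuousAlternatingMap.alternatizeUncurryFin F v =
      ((p + q).factorial : ℝ)⁻¹ • ((p.factorial : ℝ) * (q.factorial : ℝ))⁻¹ •
        antisymm (fun w => antisymm (fun u => a (fun i => u (Fin.castAdd q i)) •
          B (w 0) (fun j => u (Fin.natAdd p j))) (w ∘ Fin.succEmb (p + q))) v := by
    rw [alternatizeUncurryFin_eq_antisymm]
    simp only [hF, wedge_apply, antisymm_smul]
    rfl
  have e2 : wedge h' a (ContinuousAlternatingMap.alternatizeUncurryFin B) v =
      ((p.factorial : ℝ) * ((q + 1).factorial : ℝ))⁻¹ • ((q.factorial : ℝ))⁻¹ •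
        antisymm (fun w => antisymm (fun u : Fin (q + 1) → V =>
          a (fun i => w (Fin.cast h' (Fin.castAdd (q + 1) i))) • B (u 0) (Fin.tail u))
            (w ∘ (Fin.natAddEmb p).trans (finCongr h').toEmbedding)) v := by
    rw [wedge_apply, ← antisymm_smul ((_ : ℝ)⁻¹) (fun w => antisymm _ _)]
    congr 1
    refine congrArg (antisymm · v) (funext fun w => ?_)
    rw [alternatizeUncurryFin_eq_antisymm, smul_comm, antisymm_smul]
    rfl
  rw [ContinuousAlternatingMap.smul_apply, e1, e2, hl, hr, hlr, hc,
    Equiv.Perm.sign_symm, Fin.sign_cycleRange]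
  have hs : ∀ x : W, ((-1 : ℤˣ) ^ p) • x = (-1 : ℝ) ^ p • x := by
    intro x
    rcases Nat.even_or_odd p with h | h <;> simp [h.neg_one_pow]
  have hs2 : (-1 : ℝ) ^ p * (-1 : ℝ) ^ p = 1 := by rw [← mul_pow]; simp
  simp only [i₀, hs, Fintype.card_fin, ← Nat.cast_smul_eq_nsmul ℝ, smul_smul]
  congr 1
  have := Nat.factorial_pos (p + q)
  have := Nat.factorial_pos (q + 1)
  field_simp
  linear_combination -hs2

end WedgeUncurry

section WedgeBilinear

variable {V V' W W' : Type*} [NormedAddCommGroup V] [NormedSpace ℝ V] [NormedAddCommGroup W]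
  [NormedSpace ℝ W] [NormedAddCommGroup V'] [NormedSpace ℝ V'] [NormedAddCommGroup W']
  [NormedSpace ℝ W']

/-- Makes every bilinear map on alternating forms continuous, in particular the wedge product. -/
instance finiteDimensional_continuousAlternatingMap [FiniteDimensional ℝ V]
    [FiniteDimensional ℝ W] (p : ℕ) : FiniteDimensional ℝ (V [⋀^Fin p]→L[ℝ] W) :=
  Module.Finite.of_injective
    ((AlternatingMap.toMultilinearMapLM (R := ℝ) (S := ℝ) (M := V) (N := W) (ι := Fin p)).comp
      (ContinuousAlternatingMap.toAlternatingMapLinear (R := ℝ) (A := ℝ)))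
    (AlternatingMap.coe_multilinearMap_injective.comp
      ContinuousAlternatingMap.toAlternatingMap_injective)

/-- The wedge product as a continuous bilinear map. -/
def wedgeL [FiniteDimensional ℝ V] [FiniteDimensional ℝ W] {p q r : ℕ}
    (h : p + q = r) :
    (V [⋀^Fin p]→L[ℝ] ℝ) →L[ℝ] (V [⋀^Fin q]→L[ℝ] W) →L[ℝ] (V [⋀^Fin r]→L[ℝ] W) :=
  LinearMap.toContinuousBilinearMap <| LinearMap.mk₂ ℝ (wedge h)
    (fun a a' b => by ext v; simp [wedge_apply, add_smul, antisymm_add])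
    (fun c a b => by
      ext v
      simp only [wedge_apply, ContinuousAlternatingMap.smul_apply, smul_assoc, antisymm_smul]
      rw [smul_comm c])
    (fun a b b' => by ext v; simp [wedge_apply, smul_add, antisymm_add])
    (fun c a b => by
      ext v
      simp only [wedge_apply, ContinuousAlternatingMap.smul_apply, smul_comm _ c, antisymm_smul])

@[simp]
theorem wedgeL_apply [FiniteDimensional ℝ V] [FiniteDimensional ℝ W] {p q r : ℕ}
    (h : p + q = r) (a : V [⋀^Fin p]→L[ℝ] ℝ)
    (b : V [⋀^Fin q]→L[ℝ] W) : wedgeL h a b = wedge h a b := rfl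

/-- Naturality of the wedge product in the arguments and in the values of the second factor. -/
theorem wedge_comp {p q r : ℕ} (h : p + q = r) (a : V [⋀^Fin p]→L[ℝ] ℝ)
    (b : V [⋀^Fin q]→L[ℝ] W) (T : V' →L[ℝ] V) (S : W →L[ℝ] W') :
    S.compContinuousAlternatingMap ((wedge h a b).compContinuousLinearMap T) =
      wedge h (a.compContinuousLinearMap T)
        (S.compContinuousAlternatingMap (b.compContinuousLinearMap T)) := by
  ext v
  simp only [ContinuousLinearMap.compContinuousAlternatingMap_coe, Function.comp_apply,
    ContinuousAlternatingMap.compContinuousLinearMap_apply, wedge_apply, map_smul]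
  congr 1
  rw [← antisymm_precomp]
  exact (antisymm_map (S : W →+ W') _ v).symm.trans (by simp [Function.comp_def])

end WedgeBilinear

/-! ### Covariant derivatives of vector-valued forms on an open set of a vector space -/

section LocalCalculus

open ContinuousAlternatingMap (alternatizeUncurryFin alternatizeUncurryFinCLM
  alternatizeUncurryFin_add alternatizeUncurryFin_smul alternatizeUncurryFin_apply)

variable {V W : Type*} [NormedAddCommGroup V] [NormedSpace ℝ V] [NormedAddCommGroup W]
  [NormedSpace ℝ W]

/-- The action `u ↦ c(u) ∘ a` of an endomorphism-valued one-form `c` on a `W`-valued `p`-form `a`,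
before alternatization. -/
def connAct {p : ℕ} (c : V →L[ℝ] W →L[ℝ] W) (a : V [⋀^Fin p]→L[ℝ] W) :
    V →L[ℝ] V [⋀^Fin p]→L[ℝ] W :=
  ((ContinuousLinearMap.compContinuousAlternatingMapCLM ℝ V W W (Fin p)).flip a).comp c

@[simp]
theorem connAct_apply {p : ℕ} (c : V →L[ℝ] W →L[ℝ] W) (a : V [⋀^Fin p]→L[ℝ] W) (u : V)
    (v : Fin p → V) : connAct c a u v = c u (a v) := rfl

/-- The exterior covariant derivative `dα + C ∧ α` for a connection form `C`. -/
def covD {p : ℕ} (C : V → V →L[ℝ] W →L[ℝ] W) (α : V → V [⋀^Fin p]→L[ℝ] W) (y : V) :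
    V [⋀^Fin (p + 1)]→L[ℝ] W :=
  alternatizeUncurryFin (fderiv ℝ α y + connAct (C y) (α y))

/-- The curvature `dC + C ∧ C` of a connection form `C`, evaluated at two vectors. -/
def curv (C : V → V →L[ℝ] W →L[ℝ] W) (y u w : V) : W →L[ℝ] W :=
  fderiv ℝ C y u w - fderiv ℝ C y w u + ((C y u).comp (C y w) - (C y w).comp (C y u))

theorem covD_add {p : ℕ} {C : V → V →L[ℝ] W →L[ℝ] W} {α β : V → V [⋀^Fin p]→L[ℝ] W} {y : V}
    (hα : DifferentiableAt ℝ α y) (hβ : DifferentiableAt ℝ β y) :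
    covD C (α + β) y = covD C α y + covD C β y := by
  rw [covD, covD, covD, ← alternatizeUncurryFin_add, fderiv_add hα hβ]
  congr 1
  ext
  simp
  abel

theorem covD_smul {p : ℕ} {C : V → V →L[ℝ] W →L[ℝ] W} {α : V → V [⋀^Fin p]→L[ℝ] W} {y : V}
    (c : ℝ) : covD C (c • α) y = c • covD C α y := by
  have h : connAct (C y) (c • α y) = c • connAct (C y) (α y) := by
    ext
    simp
  have hd := extDeriv_smul (x := y) c α
  simp only [extDeriv] at hd
  rw [covD, covD, alternatizeUncurryFin_add, alternatizeUncurryFin_add, hd, Pi.smul_apply, h,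
    alternatizeUncurryFin_smul, smul_add]

theorem _root_.Filter.EventuallyEq.covD_eq {p : ℕ} {C : V → V →L[ℝ] W →L[ℝ] W}
    {α β : V → V [⋀^Fin p]→L[ℝ] W} {y : V} (h : α =ᶠ[nhds y] β) : covD C α y = covD C β y := by
  rw [covD, covD, h.fderiv_eq, h.eq_of_nhds]

/-- The Leibniz rule for `d + C ∧ ·`. -/
theorem covD_wedge [FiniteDimensional ℝ V] [FiniteDimensional ℝ W] {p q r : ℕ} (h : p + q = r)
    (C : V → V →L[ℝ] W →L[ℝ] W) {a : V → V [⋀^Fin p]→L[ℝ] ℝ} {b : V → V [⋀^Fin q]→L[ℝ] W} {y : V}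
    (ha : DifferentiableAt ℝ a y) (hb : DifferentiableAt ℝ b y) :
    covD C (fun z => wedge h (a z) (b z)) y =
      wedge (show (p + 1) + q = r + 1 by omega) (extDeriv a y) (b y) +
        (-1 : ℝ) ^ p • wedge (show p + (q + 1) = r + 1 by omega) (a y) (covD C b y) := by
  have hd := ((wedgeL (V := V) (W := W) h).hasFDerivAt_of_bilinear
    ha.hasFDerivAt hb.hasFDerivAt).fderiv
  simp only [wedgeL_apply] at hd
  have e : fderiv ℝ (fun z => wedge h (a z) (b z)) y + connAct (C y) (wedge h (a y) (b y)) =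
      ((wedgeL h).flip (b y)).comp (fderiv ℝ a y) +
        (wedgeL h (a y)).comp (fderiv ℝ b y + connAct (C y) (b y)) := by
    rw [hd]
    ext1 u
    have hc : connAct (C y) (wedge h (a y) (b y)) u =
        wedge h (a y) (connAct (C y) (b y) u) :=
      wedge_comp h (a y) (b y) (ContinuousLinearMap.id ℝ V) (C y u)
    simp only [add_apply, hc, ContinuousLinearMap.comp_apply, map_add,
      ContinuousLinearMap.precompR_apply, ContinuousLinearMap.precompL_apply,
      ContinuousLinearMap.flip_apply, ContinuousLinearMap.compL_apply, wedgeL_apply]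
    abel
  rw [covD, e, alternatizeUncurryFin_add]
  congr 1
  · exact alternatizeUncurryFin_wedge_left h _ (fderiv ℝ a y) (b y) _ fun u => rfl
  · exact alternatizeUncurryFin_wedge_right h _ (a y) _ _ fun u => rfl

theorem connAct_differentiableAt {p : ℕ} {C : V → V →L[ℝ] W →L[ℝ] W}
    {α : V → V [⋀^Fin p]→L[ℝ] W} {y : V} (hα : DifferentiableAt ℝ α y)
    (hC : DifferentiableAt ℝ C y) :
    DifferentiableAt ℝ (fun z => connAct (C z) (α z)) y :=
  ((ContinuousLinearMap.differentiableAt _).comp y hα).clm_comp hC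

theorem fderiv_connAct_apply {p : ℕ} {C : V → V →L[ℝ] W →L[ℝ] W}
    {α : V → V [⋀^Fin p]→L[ℝ] W} {y : V} (hα : DifferentiableAt ℝ α y)
    (hC : DifferentiableAt ℝ C y) (u w : V) (v : Fin p → V) :
    fderiv ℝ (fun z => connAct (C z) (α z)) y u w v =
      fderiv ℝ C y u w (α y v) + C y w (fderiv ℝ α y u v) := by
  have h0 : HasFDerivAt (ContinuousLinearMap.compContinuousAlternatingMapCLM ℝ V W W
    (Fin p)).flip _ (α y) := ContinuousLinearMap.hasFDerivAt _
  have h1 := HasFDerivAt.comp (F := V [⋀^Fin p]→L[ℝ] W)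
    (G := (W →L[ℝ] W) →L[ℝ] V [⋀^Fin p]→L[ℝ] W) y h0 hα.hasFDerivAt
  have := (h1.clm_comp hC.hasFDerivAt).fderiv
  simp only [Function.comp_def] at this
  simp only [connAct]
  rw [this]
  simp [add_comm]

/-- The square of the exterior covariant derivative is the action of the curvature. -/
theorem covD_covD {p : ℕ} {C : V → V →L[ℝ] W →L[ℝ] W}
    {α : V → V [⋀^Fin p]→L[ℝ] W} {y : V} (hα : ContDiffAt ℝ 2 α y)
    (hC : DifferentiableAt ℝ C y) (v : Fin (p + 2) → V) :
    covD C (covD C α) y v = (2 * (p.factorial : ℝ))⁻¹ •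
      antisymm (fun w => curv C y (w 0) (w 1) (α y (Fin.tail (Fin.tail w)))) v := by
  have hα1 : DifferentiableAt ℝ α y := hα.differentiableAt (by norm_num)
  have hα2 : DifferentiableAt ℝ (fderiv ℝ α) y :=
    (hα.fderiv_right (m := 1) (by norm_num)).differentiableAt (by norm_num)
  have hL : DifferentiableAt ℝ (fun z => fderiv ℝ α z + connAct (C z) (α z)) y := by
    have h3 := connAct_differentiableAt hα1 hC
    exact DifferentiableAt.fun_add (𝕜 := ℝ) (E := V) (F := V →L[ℝ] V [⋀^Fin p]→L[ℝ] W) hα2 h3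
  set L := fun z => fderiv ℝ α z + connAct (C z) (α z) with hLdef
  have hcov : covD C α = fun z => alternatizeUncurryFinCLM ℝ V W (L z) := rfl
  have hd : fderiv ℝ (covD C α) y = (alternatizeUncurryFinCLM ℝ V W).comp (fderiv ℝ L y) := by
    rw [hcov]
    exact (HasFDerivAt.comp (𝕜 := ℝ) (E := V) (F := V →L[ℝ] V [⋀^Fin p]→L[ℝ] W)
      (G := V [⋀^Fin (p + 1)]→L[ℝ] W) y
      (ContinuousLinearMap.hasFDerivAt _) hL.hasFDerivAt).fderiv
  -- `G u w` is the covariant derivative in the direction `u` of the one in the direction `w`, so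
  -- that `∇∇α` is the antisymmetrization of `G (w 0) (w 1) (w 2, …)`
  let G : V → V →L[ℝ] V [⋀^Fin p]→L[ℝ] W := fun u => fderiv ℝ L y u +
    (ContinuousLinearMap.compContinuousAlternatingMapCLM ℝ V W W (Fin p) (C y u)).comp (L y)
  have hG : ∀ u, (fderiv ℝ (covD C α) y + connAct (C y) (covD C α y)) u =
      alternatizeUncurryFin (G u) := by
    intro u
    rw [alternatizeUncurryFin_add, hd]
    simp only [add_apply]
    congr 1
    ext w
    simp [connAct_apply, hcov, alternatizeUncurryFin_apply]
  have hblock := antisymm_antisymm_block (W := W) (Fin.succEmb (p + 1))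
    (fun (w : Fin (p + 2) → V) u => G (w 0) (u 0) (Fin.tail u))
    (fun w w' hw => by
      have : w 0 = w' 0 := hw 0 (by simp)
      simp only [this]) v
  have e1 : covD C (covD C α) y v = ((p.factorial : ℝ))⁻¹ •
      antisymm (fun w => G (w 0) (w 1) (Fin.tail (Fin.tail w))) v := by
    rw [covD, alternatizeUncurryFin_eq_antisymm]
    simp only [hG, alternatizeUncurryFin_eq_antisymm (G _), antisymm_smul]
    refine (congrArg (fun x => _ • _ • x) hblock).trans ?_
    rw [Fintype.card_fin, ← Nat.cast_smul_eq_nsmul ℝ, smul_comm ((p.factorial : ℝ))⁻¹, smul_smul,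
      inv_mul_cancel₀ (by positivity), one_smul]
    rfl
  have hsymm : IsSymmSndFDerivAt ℝ α y := hα.isSymmSndFDerivAt (by simp)
  have hGv : ∀ u w x, G u w x = fderiv ℝ (fderiv ℝ α) y u w x +
      (fderiv ℝ C y u w (α y x) + C y w (fderiv ℝ α y u x)) +
      (C y u (fderiv ℝ α y w x) + C y u (C y w (α y x))) := by
    intro u w x
    have : fderiv ℝ L y u w x = fderiv ℝ (fderiv ℝ α) y u w x +
        fderiv ℝ (fun z => connAct (C z) (α z)) y u w x := by
      rw [hLdef, fderiv_fun_add (𝕜 := ℝ) (E := V) (F := V →L[ℝ] V [⋀^Fin p]→L[ℝ] W) hα2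
        (connAct_differentiableAt hα1 hC)]
      rfl
    simp only [G, add_apply, ContinuousAlternatingMap.add_apply, this,
      fderiv_connAct_apply hα1 hC]
    simp [hLdef]
  -- the terms with derivatives of `α` are symmetric in `u` and `w`
  have hdiff : ∀ u w x, G u w x = G w u x + curv C y u w (α y x) := by
    intro u w x
    rw [hGv, hGv, hsymm.eq u w]
    simp only [curv, add_apply, sub_apply,
      ContinuousLinearMap.comp_apply]
    abel
  have hswap := antisymm_comp_perm (fun w : Fin (p + 2) → V => G (w 0) (w 1)
    (Fin.tail (Fin.tail w))) (Equiv.swap 0 1) v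
  have hsw : (fun w : Fin (p + 2) → V => G ((w ∘ Equiv.swap 0 1) 0) ((w ∘ Equiv.swap 0 1) 1)
      (Fin.tail (Fin.tail (w ∘ Equiv.swap 0 1)))) =
      fun w => G (w 1) (w 0) (Fin.tail (Fin.tail w)) := by
    funext w
    have ht : Fin.tail (Fin.tail (w ∘ Equiv.swap (0 : Fin (p + 2)) 1)) =
        Fin.tail (Fin.tail w) := by
      funext i
      simp only [Fin.tail, Function.comp_apply]
      rw [Equiv.swap_apply_of_ne_of_ne]
      · exact Fin.succ_ne_zero _
      · intro h
        have := congrArg Fin.val h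
        simp at this
    simp [ht]
  have h01 : (0 : Fin (p + 2)) ≠ 1 := by simp
  rw [hsw, Equiv.Perm.sign_swap h01, Units.neg_smul, one_smul] at hswap
  have hsum := congrArg (antisymm · v) (funext fun w : Fin (p + 2) → V =>
    hdiff (w 0) (w 1) (Fin.tail (Fin.tail w)))
  simp only [antisymm_add, hswap] at hsum
  have h2 : (2 : ℝ) • antisymm (fun w : Fin (p + 2) → V =>
      G (w 0) (w 1) (Fin.tail (Fin.tail w))) v =
      antisymm (fun w => curv C y (w 0) (w 1) (α y (Fin.tail (Fin.tail w)))) v := by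
    rw [two_smul]
    nth_rewrite 1 [hsum]
    abel
  rw [e1, ← h2, smul_smul]
  congr 1
  have := Nat.factorial_pos p
  field_simp

end LocalCalculus

/-! ### Products over consecutive pairs of arguments -/

section PairProd

open Equiv

variable {X A : Type*}

/-- The product `F(w₀, w₁) F(w₂, w₃) ⋯ F(w_{2k-2}, w_{2k-1})`. -/
def pairProd [Monoid A] (F : X → X → A) {k : ℕ} (w : Fin (2 * k) → X) : A :=
  (List.ofFn fun i : Fin k => F (w ⟨2 * i, by omega⟩) (w ⟨2 * i + 1, by omega⟩)).prod

theorem pairProd_succ [Monoid A] (F : X → X → A) {k : ℕ} (w : Fin (2 * k + 2) → X) :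
    pairProd (k := k + 1) F w = F (w 0) (w 1) * pairProd F (Fin.tail (Fin.tail w)) := by
  rw [pairProd, List.ofFn_succ, List.prod_cons]
  rfl

theorem map_pairProd {B : Type*} [Monoid A] [Monoid B] (φ : A →* B) (F : X → X → A) {k : ℕ}
    (w : Fin (2 * k) → X) : φ (pairProd F w) = pairProd (fun u v => φ (F u v)) w := by
  rw [pairProd, pairProd, map_list_prod, List.map_ofFn]
  rfl

variable [Ring A] [Algebra ℝ A]

/-- The transposition of the two members of the `i`-th pair. -/
def pairSwap {k : ℕ} (i : Fin k) : Perm (Fin (2 * k)) :=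
  Equiv.swap ⟨2 * i, by omega⟩ ⟨2 * i + 1, by omega⟩

theorem sign_pairSwap {k : ℕ} (i : Fin k) : Perm.sign (pairSwap i) = -1 :=
  Perm.sign_swap (by simp [Fin.ext_iff])

theorem pairSwap_left {k : ℕ} (i : Fin k) :
    pairSwap i ⟨2 * i, by omega⟩ = ⟨2 * i + 1, by omega⟩ := Equiv.swap_apply_left _ _

theorem pairSwap_right {k : ℕ} (i : Fin k) :
    pairSwap i ⟨2 * i + 1, by omega⟩ = ⟨2 * i, by omega⟩ := Equiv.swap_apply_right _ _

theorem pairSwap_of_ne {k : ℕ} {i j : Fin k} (h : j ≠ i) :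
    pairSwap i ⟨2 * j, by omega⟩ = ⟨2 * j, by omega⟩ ∧
      pairSwap i ⟨2 * j + 1, by omega⟩ = ⟨2 * j + 1, by omega⟩ := by
  have : (j : ℕ) ≠ i := fun h' => h (Fin.ext h')
  constructor <;> refine Equiv.swap_apply_of_ne_of_ne ?_ ?_ <;> simp only [ne_eq, Fin.mk.injEq] <;>
    omega

theorem pairProd_comp_pairSwap {F : X → X → A} (hF : ∀ u v, F u v = -F v u) {k : ℕ} (i : Fin k)
    (w : Fin (2 * k) → X) : pairProd F (w ∘ pairSwap i) = -pairProd F w := by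
  -- the exchange negates one factor of a product that is multilinear in its factors
  have h := (MultilinearMap.mkPiAlgebraFin ℝ k A).map_update_neg
    (fun j : Fin k => F (w ⟨2 * j, by omega⟩) (w ⟨2 * j + 1, by omega⟩)) i
    (F (w ⟨2 * i, by omega⟩) (w ⟨2 * i + 1, by omega⟩))
  rw [Function.update_eq_self] at h
  simp only [MultilinearMap.mkPiAlgebraFin_apply] at h
  rw [pairProd, pairProd, ← h]
  congr 2
  funext j
  by_cases hj : j = i
  · subst hj
    simp only [Function.comp_apply, pairSwap_left, pairSwap_right, Function.update_self]
    exact hF _ _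
  · simp only [Function.comp_apply, (pairSwap_of_ne hj).1, (pairSwap_of_ne hj).2,
      Function.update_of_ne hj]

/-- The signed sum over all permutations that are increasing on the pairs in `S`. Every further
pair in which the order is not prescribed doubles the sum. -/
theorem antisymm_pairProd_eq {F : X → X → A} (hF : ∀ u v, F u v = -F v u) {k : ℕ}
    (w : Fin (2 * k) → X) (S : Finset (Fin k)) :
    antisymm (pairProd F) w = (2 : ℝ) ^ S.card •
      ∑ σ ∈ Finset.univ.filter (fun σ : Perm (Fin (2 * k)) =>
        ∀ i ∈ S, σ ⟨2 * i, by omega⟩ < σ ⟨2 * i + 1, by omega⟩),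
        Perm.sign σ • pairProd F (w ∘ σ) := by
  classical
  induction S using Finset.induction_on with
  | empty => simp [antisymm]
  | insert i S hi ih =>
    rw [ih, Finset.card_insert_of_notMem hi, pow_succ, mul_smul]
    congr 1
    rw [← Finset.sum_filter_add_sum_filter_not _ (fun σ : Perm (Fin (2 * k)) =>
      σ ⟨2 * i, by omega⟩ < σ ⟨2 * i + 1, by omega⟩), two_smul]
    congr 1
    · refine Finset.sum_congr (Finset.ext fun σ => ?_) fun _ _ => rfl
      simp only [Finset.mem_filter, Finset.mem_univ, true_and, Finset.forall_mem_insert]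
      exact and_comm
    -- exchanging the `i`-th pair turns the permutations that decrease on it into those that
    -- increase on it, and changes both the sign and the product by `-1`
    · refine Finset.sum_bij' (fun σ _ => σ * pairSwap i) (fun σ _ => σ * pairSwap i) ?_ ?_ ?_ ?_ ?_
      · intro σ hσ
        simp only [Finset.mem_filter, Finset.mem_univ, true_and, Finset.forall_mem_insert,
          Perm.mul_apply, pairSwap_left, pairSwap_right] at hσ ⊢
        refine ⟨lt_of_le_of_ne (not_lt.1 hσ.2) fun h => ?_, fun j hj => ?_⟩
        · simpa [Fin.ext_iff] using σ.injective h
        · have hji : j ≠ i := fun h => hi (h ▸ hj)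
          rw [(pairSwap_of_ne hji).1, (pairSwap_of_ne hji).2]
          exact hσ.1 j hj
      · intro σ hσ
        simp only [Finset.mem_filter, Finset.mem_univ, true_and, Finset.forall_mem_insert,
          Perm.mul_apply, pairSwap_left, pairSwap_right] at hσ ⊢
        refine ⟨fun j hj => ?_, not_lt.2 hσ.1.le⟩
        have hji : j ≠ i := fun h => hi (h ▸ hj)
        rw [(pairSwap_of_ne hji).1, (pairSwap_of_ne hji).2]
        exact hσ.2 j hj
      · intro σ _
        simp [mul_assoc, pairSwap]
      · intro σ _
        simp [mul_assoc, pairSwap]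
      · intro σ _
        rw [Perm.sign_mul, sign_pairSwap, Perm.coe_mul, ← Function.comp_assoc,
          pairProd_comp_pairSwap hF]
        simp

/-- Expansion of a product of bilinear expressions in the coordinates of the arguments. -/
theorem pairProd_sum {n : ℕ} (R : Fin n → Fin n → A) {k : ℕ} (w : Fin (2 * k) → Fin n → ℝ) :
    pairProd (fun u v : Fin n → ℝ => ∑ a, ∑ b, (u a * v b) • R a b) w =
      ∑ r : Fin (2 * k) → Fin n, (∏ i, w i (r i)) • pairProd R r := by
  induction k with
  | zero => simp [pairProd]
  | succ k ih =>
    rw [pairProd_succ, ih]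
    have e : ∀ (m : ℕ) (f : (Fin (m + 1) → Fin n) → A),
        ∑ r, f r = ∑ a, ∑ r, f (Fin.cons a r) := by
      intro m f
      rw [← Fintype.sum_prod_type']
      exact (Fintype.sum_equiv (Fin.consEquiv fun _ => Fin n) _ _ fun x => rfl).symm
    refine Eq.trans ?_ (e (2 * k + 1) _).symm
    simp only [e (2 * k), Finset.sum_mul]
    refine Finset.sum_congr rfl fun a _ => Finset.sum_congr rfl fun b _ => ?_
    rw [Finset.mul_sum]
    refine Finset.sum_congr rfl fun r _ => ?_
    rw [pairProd_succ, smul_mul_smul_comm]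
    congr 1
    exact ((Fin.prod_univ_succ _).trans (by
      rw [Fin.prod_univ_succ, ← mul_assoc]; rfl)).symm

/-- The antisymmetrized product vanishes on all vectors if it vanishes on the basis vectors. -/
theorem antisymm_pairProd_sum_eq_zero {n : ℕ} {R : Fin n → Fin n → A} {k : ℕ}
    (h : ∀ s : Fin (2 * k) → Fin n, antisymm (pairProd R) s = 0) (w : Fin (2 * k) → Fin n → ℝ) :
    antisymm (pairProd fun u v : Fin n → ℝ => ∑ a, ∑ b, (u a * v b) • R a b) w = 0 := by
  have h1 : antisymm (pairProd fun u v : Fin n → ℝ => ∑ a, ∑ b, (u a * v b) • R a b) w =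
      ∑ σ : Perm (Fin (2 * k)), ∑ r : Fin (2 * k) → Fin n,
        (∏ i, w i (r i)) • Perm.sign σ • pairProd R (r ∘ σ) := by
    refine Finset.sum_congr rfl fun σ _ => ?_
    rw [pairProd_sum, Finset.smul_sum]
    refine (Fintype.sum_equiv (Equiv.arrowCongr σ (Equiv.refl _)) _ _ fun r => ?_)
    have hp : ∏ i, (w ∘ σ) i (r i) =
        ∏ i, w i (Equiv.arrowCongr σ (Equiv.refl (Fin n)) r i) :=
      Fintype.prod_equiv σ _ _ fun i => by simp
    have hc : Equiv.arrowCongr σ (Equiv.refl (Fin n)) r ∘ σ = r := by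
      funext i
      simp
    rw [← hp, hc, smul_comm]
  rw [h1, Finset.sum_comm]
  refine Finset.sum_eq_zero fun r _ => ?_
  rw [← Finset.smul_sum]
  exact (congrArg _ (h r)).trans (smul_zero _)

/-- An antisymmetrized function of indices vanishes as soon as it vanishes on increasing
families. -/
theorem antisymm_eq_zero_of_orderEmb {n m : ℕ} (P : (Fin m → Fin n) → A)
    (h : ∀ (S : Finset (Fin n)) (hS : S.card = m), antisymm P (S.orderEmbOfFin hS) = 0)
    (s : Fin m → Fin n) : antisymm P s = 0 := by
  by_cases hs : Function.Injective s
  · have hS : (Finset.univ.image s).card = m := by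
      rw [Finset.card_image_of_injective _ hs, Finset.card_fin]
    set S := Finset.univ.image s
    let f : Fin m → Fin m := fun i => (S.orderIsoOfFin hS).symm ⟨s i, by simp [S]⟩
    have hf : ∀ i, S.orderEmbOfFin hS (f i) = s i := fun i => by
      simp [f, ← Finset.coe_orderIsoOfFin_apply]
    have hfi : Function.Injective f := fun i j hij => hs (by rw [← hf, ← hf, hij])
    have hsf : s = S.orderEmbOfFin hS ∘
        Equiv.ofBijective f (Finite.injective_iff_bijective.1 hfi) :=
      funext fun i => (hf i).symm
    rw [hsf, antisymm_apply_comp, h, smul_zero]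
  · simp only [Function.Injective, not_forall] at hs
    obtain ⟨i, j, hij, hne⟩ := hs
    have h1 := antisymm_apply_comp P (Equiv.swap i j) s
    have h2 : s ∘ Equiv.swap i j = s := by
      rw [Equiv.comp_swap_eq_update, hij, Function.update_eq_self, ← hij, Function.update_eq_self]
    rw [h2, Perm.sign_swap hne, Units.neg_smul, one_smul] at h1
    have h3 : (2 : ℝ) • antisymm P s = 0 := by
      rw [two_smul]
      nth_rewrite 1 [h1]
      exact neg_add_cancel _
    exact (smul_eq_zero.1 h3).resolve_left two_ne_zero

end PairProd

/-- At the members of `S` in increasing order, the sum over all permutations counts every ordered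
pairing of `S` once for each of the `2 ^ k` choices of an order in its pairs. -/
theorem antisymm_pairProd_eq_pairingSum {n k : ℕ} {R : Fin n → Fin n → Matrix (Fin n) (Fin n) ℝ}
    (hR : ∀ a b, R a b = -R b a) (S : Finset (Fin n)) (hS : S.card = 2 * k) :
    antisymm (pairProd R) (S.orderEmbOfFin hS) = (2 : ℝ) ^ k • pairingSum R S hS := by
  rw [antisymm_pairProd_eq hR _ Finset.univ, Finset.card_fin, pairingSum, orderedPairings]
  simp only [Finset.mem_univ, true_implies]
  congr 1
  refine Finset.sum_congr rfl fun σ _ => ?_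
  rw [Units.smul_def, Int.cast_smul_eq_zsmul]
  rfl

/-- The pairing sums are the components of the alternating map given by the antisymmetrized
product. -/
theorem antisymm_pairProd_sum_eq_zero_iff {n k : ℕ}
    {R : Fin n → Fin n → Matrix (Fin n) (Fin n) ℝ} (hR : ∀ a b, R a b = -R b a) :
    (∀ w, antisymm (pairProd (k := k)
      fun u v : Fin n → ℝ => ∑ a, ∑ b, (u a * v b) • R a b) w = 0) ↔
      ∀ (S : Finset (Fin n)) (hS : S.card = 2 * k), pairingSum R S hS = 0 := by
  constructor
  · intro h S hS
    have h1 := h fun i => Pi.single (S.orderEmbOfFin hS i) 1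
    have h2 : antisymm (pairProd (k := k) fun u v : Fin n → ℝ => ∑ a, ∑ b, (u a * v b) • R a b)
        (fun i => Pi.single (S.orderEmbOfFin hS i) 1) =
        antisymm (pairProd R) (S.orderEmbOfFin hS) := by
      refine Finset.sum_congr rfl fun σ _ => ?_
      congr 1
      simp only [pairProd]
      congr 2
      funext i
      simp [Pi.single_apply]
    rw [h2, antisymm_pairProd_eq_pairingSum hR] at h1
    exact (smul_eq_zero.1 h1).resolve_left (by positivity)
  · intro h
    refine antisymm_pairProd_sum_eq_zero (antisymm_eq_zero_of_orderEmb _ fun S hS => ?_)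
    rw [antisymm_pairProd_eq_pairingSum hR, h, smul_zero]

/-! ### Powers of the curvature acting on forms -/

section CurvaturePower

open Equiv

theorem antisymm_reindex {ι κ X W : Type*} [Fintype ι] [DecidableEq ι] [Fintype κ] [DecidableEq κ]
    [AddCommGroup W] (e : κ ≃ ι) (f : (κ → X) → W) (v : ι → X) :
    antisymm (fun w => f (w ∘ e)) v = antisymm f (v ∘ e) := by
  refine Fintype.sum_equiv e.symm.permCongr _ _ fun σ => ?_
  rw [Perm.sign_permCongr]
  congr 1
  refine congrArg f (funext fun i => ?_)
  simp

variable {V W : Type*} [NormedAddCommGroup W] [NormedSpace ℝ W]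

/-- The function `Ω(w₀, w₁) Ω(w₂, w₃) ⋯ Ω(w_{2k-2}, w_{2k-1}) f(w_{2k}, …, w_{2k+p-1})`. -/
def curvPow (Ω : V → V → W →L[ℝ] W) {p : ℕ} (f : (Fin p → V) → W) :
    ∀ k : ℕ, (Fin (p + 2 * k) → V) → W
  | 0, w => f w
  | k + 1, w => Ω (w 0) (w 1) (curvPow Ω f k (Fin.tail (Fin.tail w)))

theorem curvPow_eq_pairProd (Ω : V → V → W →L[ℝ] W) {p : ℕ} (f : (Fin p → V) → W) (k : ℕ)
    (w : Fin (p + 2 * k) → V) :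
    curvPow Ω f k w = pairProd (k := k) Ω (fun i => w ⟨i, by omega⟩)
      (f fun j => w ⟨2 * k + j, by omega⟩) := by
  induction k with
  | zero => simp [curvPow, pairProd]
  | succ k ih =>
    rw [curvPow, ih]
    refine Eq.trans ?_ (DFunLike.congr_fun (pairProd_succ Ω
      (fun i : Fin (2 * k + 2) => w ⟨i, by omega⟩)).symm _)
    rw [mul_apply_eq_comp]
    have h2 : ∀ j : Fin p, Fin.tail (Fin.tail w)
        ⟨2 * k + j, show 2 * k + (j : ℕ) < p + 2 * k by omega⟩ =
        w ⟨2 * (k + 1) + j, by omega⟩ := fun j => congrArg w (Fin.ext (by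
        simp only [Fin.val_succ]
        omega))
    simp only [h2]
    rfl

/-- If `Ω^k` antisymmetrizes to zero as an endomorphism, its action on every form is zero: sum
first over the permutations of the `2k` arguments of `Ω^k`. -/
theorem antisymm_curvPow_eq_zero {Ω : V → V → W →L[ℝ] W} {k : ℕ}
    (h : ∀ w, antisymm (pairProd (k := k) Ω) w = 0) {p : ℕ} (f : (Fin p → V) → W)
    (v : Fin (p + 2 * k) → V) : antisymm (curvPow Ω f k) v = 0 := by
  let e : Fin (2 * k) ↪ Fin (p + 2 * k) := ⟨fun i => ⟨i, by omega⟩, fun i j hij => by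
    simpa [Fin.ext_iff] using hij⟩
  have hb := antisymm_antisymm_block (W := W) e
    (fun (w : Fin (p + 2 * k) → V) u => pairProd Ω u (f fun j => w ⟨2 * k + j, by omega⟩))
    (fun w w' hw => by
      have : ∀ j : Fin p, w ⟨2 * k + j, by omega⟩ = w' ⟨2 * k + j, by omega⟩ := fun j => hw _ (by
        rintro ⟨i, hi⟩
        have := congrArg Fin.val hi
        change (i : ℕ) = 2 * k + j at this
        omega)
      simp only [this]) v
  have h0 : ∀ w : Fin (p + 2 * k) → V,
      antisymm (fun u => pairProd Ω u (f fun j => w ⟨2 * k + j, by omega⟩)) (w ∘ e) = 0 := by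
    intro w
    have := antisymm_map ((ContinuousLinearMap.apply ℝ W
      (f fun j => w ⟨2 * k + j, by omega⟩)) : (W →L[ℝ] W) →+ W) (pairProd (k := k) Ω) (w ∘ e)
    rw [h, map_zero] at this
    exact this
  have hz : antisymm (fun _ : Fin (p + 2 * k) → V => (0 : W)) v = 0 := by simp [antisymm]
  simp only [h0, hz, ← Nat.cast_smul_eq_nsmul ℝ] at hb
  have h3 := (smul_eq_zero.1 hb.symm).resolve_left (by positivity)
  rw [← h3]
  exact congrArg (antisymm · v) (funext fun w => curvPow_eq_pairProd Ω f k w)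

/-- The converse needs the action on forms of degree zero only. -/
theorem antisymm_pairProd_eq_zero_of_curvPow {Ω : V → V → W →L[ℝ] W} {k : ℕ}
    (h : ∀ (x : W) (v : Fin (0 + 2 * k) → V), antisymm (curvPow Ω (fun _ => x) k) v = 0)
    (w : Fin (2 * k) → V) : antisymm (pairProd (k := k) Ω) w = 0 := by
  ext x
  have h1 := h x (w ∘ finCongr (by omega))
  have h2 : curvPow Ω (fun _ : Fin 0 → V => x) k =
      fun w => (fun u => pairProd Ω u x) (w ∘ finCongr (show 2 * k = 0 + 2 * k by omega)) := by
    funext w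
    rw [curvPow_eq_pairProd]
    rfl
  rw [h2, antisymm_reindex (finCongr (show 2 * k = 0 + 2 * k by omega))
    (fun u => pairProd Ω u x)] at h1
  exact (antisymm_map ((ContinuousLinearMap.apply ℝ W x) : (W →L[ℝ] W) →+ W)
    (pairProd (k := k) Ω) w).symm.trans h1

variable [NormedAddCommGroup V] [NormedSpace ℝ V]

/-- The iterates of the exterior covariant derivative. -/
def covIter (C : V → V →L[ℝ] W →L[ℝ] W) {p : ℕ} (α : V → V [⋀^Fin p]→L[ℝ] W) :
    ∀ N : ℕ, V → V [⋀^Fin (p + N)]→L[ℝ] W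
  | 0 => α
  | N + 1 => covD C (covIter C α N)

theorem contDiffOn_covD {p : ℕ} {C : V → V →L[ℝ] W →L[ℝ] W} {α : V → V [⋀^Fin p]→L[ℝ] W}
    {U : Set V} (hU : IsOpen U) (hC : ContDiffOn ℝ ∞ C U) (hα : ContDiffOn ℝ ∞ α U) :
    ContDiffOn ℝ ∞ (covD C α) U := by
  have h1 : ContDiffOn ℝ ∞ (fderiv ℝ α) U := hα.fderiv_of_isOpen hU (by simp)
  have h2 : ContDiffOn ℝ ∞ (fun z => connAct (C z) (α z)) U :=
    ((ContinuousLinearMap.contDiff _).comp_contDiffOn hα).clm_comp hC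
  exact (ContinuousLinearMap.contDiff
    (ContinuousAlternatingMap.alternatizeUncurryFinCLM ℝ V W)).comp_contDiffOn (h1.add h2)

theorem contDiffOn_covIter {p : ℕ} {C : V → V →L[ℝ] W →L[ℝ] W} {α : V → V [⋀^Fin p]→L[ℝ] W}
    {U : Set V} (hU : IsOpen U) (hC : ContDiffOn ℝ ∞ C U) (hα : ContDiffOn ℝ ∞ α U) (N : ℕ) :
    ContDiffOn ℝ ∞ (covIter C α N) U := by
  induction N with
  | zero => exact hα
  | succ N ih => exact contDiffOn_covD hU hC ih

/-- Even iterates of the exterior covariant derivative are algebraic: they are the action of the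
powers of the curvature. -/
theorem covIter_two_mul {p : ℕ} {C : V → V →L[ℝ] W →L[ℝ] W} {α : V → V [⋀^Fin p]→L[ℝ] W}
    {U : Set V} (hU : IsOpen U) (hC : ContDiffOn ℝ ∞ C U) (hα : ContDiffOn ℝ ∞ α U) (k : ℕ)
    {y : V} (hy : y ∈ U) (v : Fin (p + 2 * k) → V) :
    covIter C α (2 * k) y v = ((2 : ℝ) ^ k * p.factorial)⁻¹ •
      antisymm (curvPow (curv C y) (α y) k) v := by
  induction k with
  | zero =>
    have h := antisymm_eq_factorial_smul (fun w => α y w)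
      (fun τ w => (α y).toAlternatingMap.map_perm w τ) v
    refine Eq.trans ?_ (congrArg (fun x => ((2 : ℝ) ^ 0 * p.factorial)⁻¹ • x) h.symm)
    rw [Fintype.card_fin, ← Nat.cast_smul_eq_nsmul ℝ, smul_smul, pow_zero, one_mul,
      inv_mul_cancel₀ (by positivity), one_smul]
    rfl
  | succ k ih =>
    have hs := ((contDiffOn_covIter hU hC hα (2 * k)).contDiffAt (hU.mem_nhds hy)).of_le
      (m := 2) ENat.LEInfty.out
    have hCd := (hC.contDiffAt (hU.mem_nhds hy)).differentiableAt (by simp)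
    refine (covD_covD hs hCd v).trans ?_
    have hblock := antisymm_antisymm_block (W := W)
      -- the block of all arguments but the first two
      ((Fin.succEmb (p + 2 * k)).trans (Fin.succEmb (p + 2 * k + 1)))
      (fun (w : Fin (p + 2 * k + 2) → V) u => curv C y (w 0) (w 1) (curvPow (curv C y) (α y) k u))
      (fun w w' hw => by
        have h0 : w 0 = w' 0 := hw 0 (by simp)
        have h1 : w 1 = w' 1 := hw 1 (by
          rintro ⟨i, hi⟩
          have := congrArg Fin.val hi
          simp at this)
        simp only [h0, h1]) v
    have e : ∀ w : Fin (p + 2 * k + 2) → V,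
        curv C y (w 0) (w 1) (covIter C α (2 * k) y (Fin.tail (Fin.tail w))) =
        ((2 : ℝ) ^ k * p.factorial)⁻¹ • antisymm (fun u => curv C y (w 0) (w 1)
          (curvPow (curv C y) (α y) k u))
          (w ∘ (Fin.succEmb (p + 2 * k)).trans (Fin.succEmb (p + 2 * k + 1))) := by
      intro w
      rw [ih, map_smul]
      congr 1
      exact (antisymm_map (curv C y (w 0) (w 1) : W →+ W) _ _).symm
    simp only [e, antisymm_smul]
    rw [hblock, Fintype.card_fin, ← Nat.cast_smul_eq_nsmul ℝ, smul_smul, smul_smul]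
    refine congrArg (fun c : ℝ => c • antisymm (curvPow (curv C y) (α y) (k + 1)) v) ?_
    have := Nat.factorial_pos (p + 2 * k)
    have := Nat.factorial_pos p
    field_simp
    rw [pow_succ']

end CurvaturePower

/-! ### Covariant derivatives under a change of coordinates -/

section ChangeOfCoordinates

variable {V : Type*} [NormedAddCommGroup V] [NormedSpace ℝ V]

/-- If the connection forms `C` and `C'` are related by the transformation law
`C'(Tu, Tv) + DT(u) v = T C(u, v)`, where `T` is the derivative of the coordinate change `φ`, then
the exterior covariant derivatives of related forms are related. -/
theorem covD_change {p : ℕ} {φ : V → V} {C C' : V → V →L[ℝ] V →L[ℝ] V}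
    {α α' : V → V [⋀^Fin p]→L[ℝ] V} {y : V} (hφ : ContDiffAt ℝ 2 φ y)
    (hα : DifferentiableAt ℝ α y) (hα' : DifferentiableAt ℝ α' (φ y))
    (hrel : ∀ᶠ z in nhds y, (fderiv ℝ φ z).compContinuousAlternatingMap (α z) =
      (α' (φ z)).compContinuousLinearMap (fderiv ℝ φ z))
    (hC : ∀ u v, C' (φ y) (fderiv ℝ φ y u) (fderiv ℝ φ y v) + fderiv ℝ (fderiv ℝ φ) y u v =
      fderiv ℝ φ y (C y u v)) :
    (fderiv ℝ φ y).compContinuousAlternatingMap (covD C α y) =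
      (covD C' α' (φ y)).compContinuousLinearMap (fderiv ℝ φ y) := by
  set T := fderiv ℝ φ with hT
  have hTd : DifferentiableAt ℝ T y :=
    (hφ.fderiv_right (m := 1) (by norm_num)).differentiableAt (by norm_num)
  -- `hrel` says that `T α = φ^* α'`; take the exterior derivative of both sides
  have hpull : extDeriv (fun z => (T z).compContinuousAlternatingMap (α z)) y =
      (extDeriv α' (φ y)).compContinuousLinearMap (T y) := by
    rw [Filter.EventuallyEq.extDeriv_eq hrel]
    exact extDeriv_pullback hα' hφ (by simp)
  have hd : ∀ u v, fderiv ℝ (fun z => (T z).compContinuousAlternatingMap (α z)) y u v =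
      fderiv ℝ T y u (α y v) + T y (fderiv ℝ α y u v) := by
    intro u v
    have := ((ContinuousLinearMap.compContinuousAlternatingMapCLM ℝ V V V
      (Fin p)).hasFDerivAt_of_bilinear hTd.hasFDerivAt hα.hasFDerivAt).fderiv
    have h2 : (fun z => (T z).compContinuousAlternatingMap (α z)) = fun z =>
      ContinuousLinearMap.compContinuousAlternatingMapCLM ℝ V V V (Fin p) (T z) (α z) := rfl
    rw [h2, this]
    simp [add_comm]
  ext v
  have hpv := DFunLike.congr_fun hpull v
  have hy : ∀ w, T y (α y w) = α' (φ y) (T y ∘ w) := fun w => DFunLike.congr_fun hrel.self_of_nhds w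
  simp only [extDeriv, ContinuousAlternatingMap.alternatizeUncurryFin_apply, hd,
    ContinuousAlternatingMap.compContinuousLinearMap_apply] at hpv
  simp only [covD, ContinuousLinearMap.compContinuousAlternatingMap_coe, Function.comp_apply,
    ContinuousAlternatingMap.compContinuousLinearMap_apply,
    ContinuousAlternatingMap.alternatizeUncurryFin_apply, map_sum, map_zsmul, add_apply,
    connAct_apply, ContinuousAlternatingMap.add_apply, map_add, smul_add, Finset.sum_add_distrib]
    at hpv ⊢
  simp only [← hC, smul_add, Finset.sum_add_distrib]
  have h3 : ∀ i : Fin (p + 1), i.removeNth (T y ∘ v) = T y ∘ i.removeNth v := fun i => rfl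
  simp only [h3, ← hy] at hpv ⊢
  rw [← hpv]
  abel

end ChangeOfCoordinates

/-! ### Forms and vectors in charts -/

section Charts

variable {n : ℕ} {M : Type*} [TopologicalSpace M] [ChartedSpace (Eucl n) M]
  {e e' : OpenPartialHomeomorph M (Eucl n)}

theorem mdifferentiable_of_mem_maximalAtlas (he : e ∈ IsManifold.maximalAtlas (𝓡 n) ∞ M) :
    e.MDifferentiable (𝓡 n) (𝓡 n) :=
  ⟨(contMDiffOn_of_mem_maximalAtlas he).mdifferentiableOn (by simp),
    (contMDiffOn_symm_of_mem_maximalAtlas he).mdifferentiableOn (by simp)⟩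

theorem chartFrame_eq_mfderiv_symm (he : e ∈ IsManifold.maximalAtlas (𝓡 n) ∞ M) {x : M}
    (hx : x ∈ e.source) : chartFrame e x = mfderiv (𝓡 n) (𝓡 n) e.symm (e x) :=
  ContinuousLinearMap.inverse_equiv ((mdifferentiable_of_mem_maximalAtlas he).mfderiv hx)

theorem chartDeriv_chartFrame (he : e ∈ IsManifold.maximalAtlas (𝓡 n) ∞ M) {x : M}
    (hx : x ∈ e.source) (u : Eucl n) : chartDeriv e x (chartFrame e x u) = u := by
  rw [chartFrame_eq_mfderiv_symm he hx]
  exact ((mdifferentiable_of_mem_maximalAtlas he).mfderiv hx).apply_symm_apply u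

theorem chartFrame_chartDeriv (he : e ∈ IsManifold.maximalAtlas (𝓡 n) ∞ M) {x : M}
    (hx : x ∈ e.source) (u : TangentSpace (𝓡 n) x) : chartFrame e x (chartDeriv e x u) = u := by
  rw [chartFrame_eq_mfderiv_symm he hx]
  exact ((mdifferentiable_of_mem_maximalAtlas he).mfderiv hx).symm_apply_apply u

/-- The domain, in the coordinates of `e`, of the coordinate change from `e` to `e'`. -/
def overlap {X H : Type*} [TopologicalSpace X] [TopologicalSpace H]
    (e e' : OpenPartialHomeomorph X H) : Set H :=
  e.target ∩ e.symm ⁻¹' e'.source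

theorem isOpen_overlap {X H : Type*} [TopologicalSpace X] [TopologicalSpace H]
    {e e' : OpenPartialHomeomorph X H} : IsOpen (overlap e e') :=
  e.isOpen_inter_preimage_symm e'.open_source

theorem contDiffOn_transition (he : e ∈ IsManifold.maximalAtlas (𝓡 n) ∞ M)
    (he' : e' ∈ IsManifold.maximalAtlas (𝓡 n) ∞ M) :
    ContDiffOn ℝ ∞ (e' ∘ e.symm) (overlap e e') :=
  contMDiffOn_iff_contDiffOn.1 ((contMDiffOn_of_mem_maximalAtlas he').comp
    ((contMDiffOn_symm_of_mem_maximalAtlas he).mono Set.inter_subset_left)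
      fun _ hz => hz.2)

theorem fderiv_transition (he : e ∈ IsManifold.maximalAtlas (𝓡 n) ∞ M)
    (he' : e' ∈ IsManifold.maximalAtlas (𝓡 n) ∞ M) {y : Eucl n} (hy : y ∈ overlap e e')
    (u : Eucl n) : fderiv ℝ (e' ∘ e.symm) y u =
      chartDeriv e' (e.symm y) (chartFrame e (e.symm y) u) := by
  rw [chartFrame_eq_mfderiv_symm he (e.map_target hy.1), e.right_inv hy.1, ← mfderiv_eq_fderiv,
    mfderiv_comp y ((mdifferentiable_of_mem_maximalAtlas he').mdifferentiableAt hy.2)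
      ((mdifferentiable_of_mem_maximalAtlas he).mdifferentiableAt_symm hy.1)]
  rfl

theorem chartFrame_fderiv_transition (he : e ∈ IsManifold.maximalAtlas (𝓡 n) ∞ M)
    (he' : e' ∈ IsManifold.maximalAtlas (𝓡 n) ∞ M) {y : Eucl n} (hy : y ∈ overlap e e')
    (u : Eucl n) : chartFrame e' (e.symm y) (fderiv ℝ (e' ∘ e.symm) y u) =
      chartFrame e (e.symm y) u := by
  rw [fderiv_transition he he' hy, chartFrame_chartDeriv he' hy.2]

/-- The coordinate expressions of a tangent-valued form in two charts are related by the
derivative of the coordinate change. -/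
theorem TangentForm.inChart_transition {p : ℕ} (α : TangentForm n M p)
    (he : e ∈ IsManifold.maximalAtlas (𝓡 n) ∞ M)
    (he' : e' ∈ IsManifold.maximalAtlas (𝓡 n) ∞ M) {y : Eucl n} (hy : y ∈ overlap e e') :
    (fderiv ℝ (e' ∘ e.symm) y).compContinuousAlternatingMap (α.inChart e y) =
      (α.inChart e' ((e' ∘ e.symm) y)).compContinuousLinearMap (fderiv ℝ (e' ∘ e.symm) y) := by
  have hx : e'.symm ((e' ∘ e.symm) y) = e.symm y := e'.left_inv hy.2
  ext1 v
  change fderiv ℝ (e' ∘ e.symm) y (chartDeriv e (e.symm y)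
    (α (e.symm y) (chartFrame e (e.symm y) ∘ v))) =
    chartDeriv e' (e'.symm ((e' ∘ e.symm) y)) (α (e'.symm ((e' ∘ e.symm) y))
      (chartFrame e' (e'.symm ((e' ∘ e.symm) y)) ∘ fderiv ℝ (e' ∘ e.symm) y ∘ v))
  rw [hx, fderiv_transition he he' hy, chartFrame_chartDeriv he (e.map_target hy.1)]
  congr 2
  funext i
  exact (chartFrame_fderiv_transition he he' hy _).symm

theorem ScalarForm.inChart_wedge {p q r : ℕ} (h : p + q = r) (a : ScalarForm n M p)
    (α : TangentForm n M q) (y : Eucl n) :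
    (a.wedge h α).inChart e y = RiemannianForms.wedge h (a.inChart e y) (α.inChart e y) :=
  wedge_comp (V := Eucl n) (V' := Eucl n) (W := Eucl n) (W' := Eucl n) h (a (e.symm y))
    (α (e.symm y)) (chartFrame e (e.symm y)) (chartDeriv e (e.symm y))

end Charts

/-! ### The Levi-Civita connection in charts -/

section Metric

variable {n : ℕ} {M : Type*} [TopologicalSpace M] [ChartedSpace (Eucl n) M]
  [IsManifold (𝓡 n) ∞ M] {e e' : OpenPartialHomeomorph M (Eucl n)}

/-- The metric in the coordinates of the chart `e`, as a bilinear form on `ℝⁿ`. -/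
def metricForm (g : Metric n M) (e : OpenPartialHomeomorph M (Eucl n)) (y : Eucl n) :
    Eucl n →L[ℝ] Eucl n →L[ℝ] ℝ :=
  ∑ i, ∑ j, gram g e y i j • (EuclideanSpace.proj i : Eucl n →L[ℝ] ℝ).smulRight
    (EuclideanSpace.proj j : Eucl n →L[ℝ] ℝ)

theorem metricForm_apply_eq_sum (g : Metric n M) (y u w : Eucl n) :
    metricForm g e y u w = ∑ i, ∑ j, gram g e y i j * (u i * w j) := by
  simp [metricForm, sum_apply]

theorem eucl_eq_sum (u : Eucl n) : u = ∑ i, u i • EuclideanSpace.single i (1 : ℝ) := by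
  ext j
  simp [Finset.sum_apply, Pi.single_apply]

theorem metricForm_apply (g : Metric n M) (y u w : Eucl n) :
    metricForm g e y u w =
      g.inner (e.symm y) (chartFrame e (e.symm y) u) (chartFrame e (e.symm y) w) := by
  rw [metricForm_apply_eq_sum]
  conv_rhs => rw [eucl_eq_sum u, eucl_eq_sum w]
  simp only [map_sum, map_smul, sum_apply, smul_apply, gram, Matrix.of_apply, smul_eq_mul,
    Finset.mul_sum]
  rw [Finset.sum_comm]
  refine Finset.sum_congr rfl fun i _ => Finset.sum_congr rfl fun j _ => ?_
  ring

theorem metricForm_symm (g : Metric n M) (y u w : Eucl n) :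
    metricForm g e y u w = metricForm g e y w u := by
  rw [metricForm_apply, metricForm_apply, g.symm]

theorem gram_eq_metricForm (g : Metric n M) (y : Eucl n) (i j : Fin n) :
    gram g e y i j =
      metricForm g e y (EuclideanSpace.single i 1) (EuclideanSpace.single j 1) := by
  rw [metricForm_apply]
  rfl

theorem gram_symm (g : Metric n M) (y : Eucl n) (i j : Fin n) :
    gram g e y i j = gram g e y j i := by
  rw [gram_eq_metricForm, metricForm_symm, ← gram_eq_metricForm]

/-- Smoothness of the metric in a chart: the coordinate vector fields are smooth sections of the
tangent bundle, being the images of constant vector fields under the tangent map of the inverse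
chart. -/
theorem contDiffOn_gram (g : Metric n M) (he : e ∈ IsManifold.maximalAtlas (𝓡 n) ∞ M)
    (i j : Fin n) : ContDiffOn ℝ ∞ (fun z => gram g e z i j) e.target := by
  have hframe : ∀ u : Eucl n, ContMDiffOn (𝓡 n) ((𝓡 n).prod (𝓡 n)) ∞
      (fun z => (⟨e.symm z, chartFrame e (e.symm z) u⟩ : TangentBundle (𝓡 n) M)) e.target := by
    intro u
    have h1 := (contMDiffOn_symm_of_mem_maximalAtlas he).contMDiffOn_tangentMapWithin
      (m := ∞) (by simp) e.open_target.uniqueMDiffOn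
    have h2 : ContMDiffOn (𝓡 n) ((𝓡 n).prod (𝓡 n)) ∞
        (fun z => (⟨z, u⟩ : TangentBundle (𝓡 n) (Eucl n))) e.target := by
      exact contMDiffOn_vectorSpace_iff_contDiffOn.2 contDiffOn_const
    refine (h1.comp h2 fun z hz => hz).congr fun z hz => ?_
    simp only [tangentMapWithin, Function.comp_apply]
    rw [chartFrame_eq_mfderiv_symm he (e.map_target hz), e.right_inv hz,
      mfderivWithin_of_isOpen e.open_target hz]
    rfl
  rw [← contMDiffOn_iff_contDiffOn]
  intro z hz
  have h3 : ContMDiffWithinAt (𝓡 n) ((𝓡 n).prod 𝓘(ℝ)) ∞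
      (fun m => Bundle.TotalSpace.mk' ℝ (E := Bundle.Trivial M ℝ) (e.symm m)
        (g.inner (e.symm m) (chartFrame e (e.symm m) (EuclideanSpace.single i 1))
          (chartFrame e (e.symm m) (EuclideanSpace.single j 1)))) e.target z := by
    apply ContMDiffWithinAt.clm_bundle_apply₂ (F₁ := Eucl n) (F₂ := Eucl n)
    · exact ContMDiffAt.comp_contMDiffWithinAt z g.contMDiff.contMDiffAt
        (contMDiffOn_symm_of_mem_maximalAtlas he z hz)
    · exact hframe _ z hz
    · exact hframe _ z hz
  simp only [Bundle.contMDiffWithinAt_totalSpace] at h3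
  exact h3.2

set_option maxSynthPendingDepth 3 in
theorem contDiffOn_metricForm (g : Metric n M) (he : e ∈ IsManifold.maximalAtlas (𝓡 n) ∞ M) :
    ContDiffOn ℝ ∞ (metricForm g e) e.target :=
  ContDiffOn.sum fun i _ => ContDiffOn.sum fun j _ =>
    (contDiffOn_gram g he i j).smul contDiffOn_const

theorem eq_zero_of_metricForm (g : Metric n M) (he : e ∈ IsManifold.maximalAtlas (𝓡 n) ∞ M)
    {y : Eucl n} (hy : y ∈ e.target) {u : Eucl n} (h : metricForm g e y u u = 0) : u = 0 := by
  by_contra hu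
  have h1 : chartFrame e (e.symm y) u ≠ 0 := fun h0 => hu (by
    rw [← chartDeriv_chartFrame he (e.map_target hy) u, h0, map_zero])
  rw [metricForm_apply] at h
  exact (g.pos _ _ h1).ne' h

theorem isUnit_det_gram (g : Metric n M) (he : e ∈ IsManifold.maximalAtlas (𝓡 n) ∞ M)
    {y : Eucl n} (hy : y ∈ e.target) : IsUnit (gram g e y).det := by
  rw [isUnit_iff_ne_zero]
  intro h0
  obtain ⟨v, hv, hv0⟩ := Matrix.exists_mulVec_eq_zero_iff.2 h0
  refine hv ?_
  -- a vector in the kernel of the Gram matrix has length zero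
  have : metricForm g e y (WithLp.toLp 2 v) (WithLp.toLp 2 v) = 0 := by
    rw [metricForm_apply_eq_sum]
    refine Finset.sum_eq_zero fun i _ => ?_
    have := congrFun hv0 i
    simp only [Matrix.mulVec, dotProduct, Pi.zero_apply] at this
    rw [← mul_zero (v i), ← this, Finset.mul_sum]
    exact Finset.sum_congr rfl fun j _ => by simp; ring
  have h2 := eq_zero_of_metricForm g he hy this
  funext i
  exact congrArg (fun w : Eucl n => w i) h2

theorem contDiffOn_gram_inv (g : Metric n M) (he : e ∈ IsManifold.maximalAtlas (𝓡 n) ∞ M)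
    (i j : Fin n) : ContDiffOn ℝ ∞ (fun z => (gram g e z)⁻¹ i j) e.target := by
  have hdet : ∀ A : Eucl n → Matrix (Fin n) (Fin n) ℝ,
      (∀ i j, ContDiffOn ℝ ∞ (fun z => A z i j) e.target) →
      ContDiffOn ℝ ∞ (fun z => (A z).det) e.target := by
    intro A hA
    simp only [Matrix.det_apply']
    exact ContDiffOn.sum fun σ _ => contDiffOn_const.mul (contDiffOn_prod fun i _ => hA _ _)
  have h1 : ContDiffOn ℝ ∞ (fun z => (gram g e z).adjugate i j) e.target := by
    simp only [Matrix.adjugate_apply]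
    refine hdet _ fun a b => ?_
    by_cases ha : a = j
    · subst ha
      simpa [Matrix.updateRow_self] using contDiffOn_const
    · simpa [Matrix.updateRow_ne ha] using contDiffOn_gram g he a b
  have h2 := ((hdet _ (contDiffOn_gram g he)).inv fun z hz =>
    (isUnit_det_gram g he hz).ne_zero).mul h1
  refine h2.congr fun z hz => ?_
  simp [Matrix.inv_def, Ring.inverse_eq_inv']

theorem contDiffOn_pderiv {U : Set (Eucl n)} (hU : IsOpen U) {f : Eucl n → ℝ}
    (hf : ContDiffOn ℝ ∞ f U) (k : Fin n) : ContDiffOn ℝ ∞ (pderiv k f) U :=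
  (hf.fderiv_of_isOpen hU (m := ∞) (by simp)).clm_apply contDiffOn_const

theorem contDiffOn_christoffel (g : Metric n M) (he : e ∈ IsManifold.maximalAtlas (𝓡 n) ∞ M)
    (i j k : Fin n) : ContDiffOn ℝ ∞ (christoffel g e i j k) e.target := by
  refine ContDiffOn.sum fun l _ => ?_
  have h := fun a b c => contDiffOn_pderiv e.open_target (contDiffOn_gram g he a b) c
  exact (contDiffOn_const.mul (((h l j k).add (h l k j)).sub (h j k l))).mul
    (contDiffOn_gram_inv g he i l)

/-- The connection one-form `ω = ∑ₖ ω_k dxₖ` in the coordinates of the chart `e`. -/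
def connForm (g : Metric n M) (e : OpenPartialHomeomorph M (Eucl n)) (y : Eucl n) :
    Eucl n →L[ℝ] Eucl n →L[ℝ] Eucl n :=
  ∑ k, (EuclideanSpace.proj k : Eucl n →L[ℝ] ℝ).smulRight (connectionMatrix g e k y)

theorem covDerivLocal_eq_covD (g : Metric n M) {p : ℕ} (α : Eucl n → Eucl n [⋀^Fin p]→L[ℝ] Eucl n)
    (y : Eucl n) : covDerivLocal g e α y = covD (connForm g e) α y := by
  rw [covDerivLocal, covD, ContinuousAlternatingMap.alternatizeUncurryFin_add]
  congr 2
  ext u v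
  simp [connForm, sum_apply, ContinuousAlternatingMap.sum_apply]

theorem connForm_apply (g : Metric n M) (y u v : Eucl n) (i : Fin n) :
    connForm g e y u v i = ∑ k, ∑ j, u k * (christoffel g e i j k y * v j) := by
  simp [connForm, connectionMatrix, sum_apply, Finset.mul_sum, Pi.single_apply]

set_option maxSynthPendingDepth 3 in
theorem contDiffOn_connForm (g : Metric n M) (he : e ∈ IsManifold.maximalAtlas (𝓡 n) ∞ M) :
    ContDiffOn ℝ ∞ (connForm g e) e.target := by
  refine ContDiffOn.sum fun k _ => ?_
  have h : ContDiffOn ℝ ∞ (connectionMatrix g e k) e.target :=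
    ContDiffOn.sum fun i _ => ContDiffOn.sum fun j _ =>
      (contDiffOn_christoffel g he i j k).smul contDiffOn_const
  exact (ContinuousLinearMap.contDiff (ContinuousLinearMap.smulRightL ℝ (Eucl n)
    (Eucl n →L[ℝ] Eucl n) (EuclideanSpace.proj k))).comp_contDiffOn h

end Metric

/-! ### The Koszul formula and the curvature -/

section LeviCivita

variable {n : ℕ} {M : Type*} [TopologicalSpace M] [ChartedSpace (Eucl n) M]
  [IsManifold (𝓡 n) ∞ M] {e e' : OpenPartialHomeomorph M (Eucl n)}

/-- Stated for functions with a linearity proof, so that identities which are linear in one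
variable of a larger expression can be checked on the basis without bundling the expression. -/
theorem eq_of_eq_on_basis {W : Type*} [AddCommGroup W] [Module ℝ W] {f f' : Eucl n → W}
    (hf : IsLinearMap ℝ f) (hf' : IsLinearMap ℝ f')
    (h : ∀ i, f (EuclideanSpace.single i 1) = f' (EuclideanSpace.single i 1)) (u : Eucl n) :
    f u = f' u := by
  have := (EuclideanSpace.basisFun (Fin n) ℝ).toBasis.ext (f₁ := hf.mk' f) (f₂ := hf'.mk' f')
    fun i => by simpa using h i
  exact LinearMap.congr_fun this u

theorem differentiableAt_metricForm (g : Metric n M) (he : e ∈ IsManifold.maximalAtlas (𝓡 n) ∞ M)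
    {y : Eucl n} (hy : y ∈ e.target) : DifferentiableAt ℝ (metricForm g e) y :=
  ((contDiffOn_metricForm g he).contDiffAt (e.open_target.mem_nhds hy)).differentiableAt (by simp)

theorem pderiv_gram (g : Metric n M) (he : e ∈ IsManifold.maximalAtlas (𝓡 n) ∞ M)
    {y : Eucl n} (hy : y ∈ e.target) (k i j : Fin n) :
    pderiv k (fun z => gram g e z i j) y = fderiv ℝ (metricForm g e) y (EuclideanSpace.single k 1)
      (EuclideanSpace.single i 1) (EuclideanSpace.single j 1) := by
  have hd := (differentiableAt_metricForm g he hy).hasFDerivAt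
  simp only [pderiv, gram_eq_metricForm]
  rw [((hd.clm_apply (hasFDerivAt_const _ y)).clm_apply (hasFDerivAt_const _ y)).fderiv]
  simp

theorem connForm_single (g : Metric n M) (y : Eucl n) (i j k : Fin n) :
    connForm g e y (EuclideanSpace.single k 1) (EuclideanSpace.single j 1) i =
      christoffel g e i j k y := by
  rw [connForm_apply]
  simp

/-- The Koszul formula. As the metric is nondegenerate it determines the connection form, which is
how the choice of the chart is controlled in `connForm_transition`. -/
theorem koszul (g : Metric n M) (he : e ∈ IsManifold.maximalAtlas (𝓡 n) ∞ M)
    {y : Eucl n} (hy : y ∈ e.target) (u v w : Eucl n) :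
    2 * metricForm g e y (connForm g e y u v) w =
      fderiv ℝ (metricForm g e) y u w v + fderiv ℝ (metricForm g e) y v w u -
        fderiv ℝ (metricForm g e) y w v u := by
  -- both sides are trilinear, so `u = ∂_k`, `v = ∂_j` and `w = ∂_l` suffice
  refine eq_of_eq_on_basis (f := fun u => 2 * metricForm g e y (connForm g e y u v) w)
    (f' := fun u => fderiv ℝ (metricForm g e) y u w v + fderiv ℝ (metricForm g e) y v w u -
      fderiv ℝ (metricForm g e) y w v u) ⟨fun a b => ?_, fun c a => ?_⟩
    ⟨fun a b => ?_, fun c a => ?_⟩ (fun k => ?_) u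
  · simp; ring
  · simp; ring
  · simp; ring
  · simp; ring
  refine eq_of_eq_on_basis
    (f := fun v => 2 * metricForm g e y (connForm g e y (EuclideanSpace.single k 1) v) w)
    (f' := fun v => fderiv ℝ (metricForm g e) y (EuclideanSpace.single k 1) w v +
      fderiv ℝ (metricForm g e) y v w (EuclideanSpace.single k 1) -
      fderiv ℝ (metricForm g e) y w v (EuclideanSpace.single k 1)) ⟨fun a b => ?_, fun c a => ?_⟩
    ⟨fun a b => ?_, fun c a => ?_⟩ (fun j => ?_) v
  · simp; ring
  · simp; ring
  · simp; ring
  · simp; ring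
  refine eq_of_eq_on_basis
    (f := fun w => 2 * metricForm g e y
      (connForm g e y (EuclideanSpace.single k 1) (EuclideanSpace.single j 1)) w)
    (f' := fun w => fderiv ℝ (metricForm g e) y (EuclideanSpace.single k 1) w
      (EuclideanSpace.single j 1) + fderiv ℝ (metricForm g e) y (EuclideanSpace.single j 1) w
        (EuclideanSpace.single k 1) -
      fderiv ℝ (metricForm g e) y w (EuclideanSpace.single j 1) (EuclideanSpace.single k 1))
    ⟨fun a b => ?_, fun c a => ?_⟩ ⟨fun a b => ?_, fun c a => ?_⟩ (fun l => ?_) w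
  · simp; ring
  · simp; ring
  · simp; ring
  · simp; ring
  simp only [← pderiv_gram g he hy]
  rw [metricForm_apply_eq_sum]
  simp only [connForm_single, christoffel]
  set B : Fin n → ℝ := fun l => pderiv k (fun z => gram g e z l j) y +
    pderiv j (fun z => gram g e z l k) y - pderiv l (fun z => gram g e z j k) y with hB
  have hinv : ∀ m, ∑ i, gram g e y i l * (gram g e y)⁻¹ i m = if l = m then 1 else 0 := by
    intro m
    have := congrFun (congrFun (Matrix.mul_nonsing_inv _ (isUnit_det_gram g he hy)) l) m
    rw [Matrix.mul_apply, Matrix.one_apply] at this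
    rw [← this]
    exact Finset.sum_congr rfl fun i _ => by rw [gram_symm]
  calc _ = 2 * ∑ i, gram g e y i l * ∑ m, 1 / 2 * B m * (gram g e y)⁻¹ i m := by
        simp [hB]
    _ = ∑ m, B m * ∑ i, gram g e y i l * (gram g e y)⁻¹ i m := by
        simp only [Finset.mul_sum]
        rw [Finset.sum_comm]
        refine Finset.sum_congr rfl fun m _ => Finset.sum_congr rfl fun i _ => ?_
        ring
    _ = B l := by simp [hinv]

theorem metricForm_transition (g : Metric n M) (he : e ∈ IsManifold.maximalAtlas (𝓡 n) ∞ M)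
    (he' : e' ∈ IsManifold.maximalAtlas (𝓡 n) ∞ M) {y : Eucl n} (hy : y ∈ overlap e e')
    (u w : Eucl n) : metricForm g e y u w = metricForm g e' ((e' ∘ e.symm) y)
      (fderiv ℝ (e' ∘ e.symm) y u) (fderiv ℝ (e' ∘ e.symm) y w) := by
  have hx : e'.symm ((e' ∘ e.symm) y) = e.symm y := e'.left_inv hy.2
  rw [metricForm_apply, metricForm_apply, hx, chartFrame_fderiv_transition he he' hy,
    chartFrame_fderiv_transition he he' hy]

set_option maxSynthPendingDepth 3 in
theorem fderiv_bilinear_pullback {V : Type*} [NormedAddCommGroup V] [NormedSpace ℝ V]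
    {B : V → V →L[ℝ] V →L[ℝ] ℝ} {φ : V → V} {y : V} (hB : DifferentiableAt ℝ B (φ y))
    (hφ : DifferentiableAt ℝ φ y) (hT : DifferentiableAt ℝ (fderiv ℝ φ) y) (a b c : V) :
    fderiv ℝ (fun z => B (φ z) (fderiv ℝ φ z b) (fderiv ℝ φ z c)) y a =
      fderiv ℝ B (φ y) (fderiv ℝ φ y a) (fderiv ℝ φ y b) (fderiv ℝ φ y c) +
        B (φ y) (fderiv ℝ (fderiv ℝ φ) y a b) (fderiv ℝ φ y c) +
        B (φ y) (fderiv ℝ φ y b) (fderiv ℝ (fderiv ℝ φ) y a c) := by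
  have h1 : HasFDerivAt (fun z => B (φ z)) ((fderiv ℝ B (φ y)).comp (fderiv ℝ φ y)) y :=
    hB.hasFDerivAt.comp y hφ.hasFDerivAt
  have hv : ∀ b, HasFDerivAt (fun z => fderiv ℝ φ z b) ((fderiv ℝ (fderiv ℝ φ) y).flip b) y := by
    intro b
    have := hT.hasFDerivAt.clm_apply (hasFDerivAt_const b y)
    simpa using this
  have h3 := (h1.clm_apply (hv b)).clm_apply (hv c)
  rw [h3.fderiv]
  simp
  ring

/-- The transformation law of the Christoffel symbols: the difference `X` of the two sides is
orthogonal to every vector, by the Koszul formulas in both charts and the symmetry of the second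
derivative of the coordinate change. -/
theorem connForm_transition (g : Metric n M) (he : e ∈ IsManifold.maximalAtlas (𝓡 n) ∞ M)
    (he' : e' ∈ IsManifold.maximalAtlas (𝓡 n) ∞ M) {y : Eucl n} (hy : y ∈ overlap e e')
    (u v : Eucl n) :
    connForm g e' ((e' ∘ e.symm) y) (fderiv ℝ (e' ∘ e.symm) y u) (fderiv ℝ (e' ∘ e.symm) y v) +
      fderiv ℝ (fderiv ℝ (e' ∘ e.symm)) y u v =
        fderiv ℝ (e' ∘ e.symm) y (connForm g e y u v) := by
  have hy' : (e' ∘ e.symm) y ∈ e'.target := e'.map_source hy.2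
  set φ := e' ∘ e.symm with hφdef
  have hφ : ContDiffAt ℝ 2 φ y := ((contDiffOn_transition he he').contDiffAt
    (isOpen_overlap.mem_nhds hy)).of_le ENat.LEInfty.out
  have hφd : DifferentiableAt ℝ φ y := hφ.differentiableAt (by norm_num)
  have hT : DifferentiableAt ℝ (fderiv ℝ φ) y :=
    (hφ.fderiv_right (m := 1) (by norm_num)).differentiableAt (by norm_num)
  have hsymm : IsSymmSndFDerivAt ℝ φ y := hφ.isSymmSndFDerivAt (by simp)
  have hderiv : ∀ a b c, fderiv ℝ (metricForm g e) y a b c =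
      fderiv ℝ (metricForm g e') (φ y) (fderiv ℝ φ y a) (fderiv ℝ φ y b) (fderiv ℝ φ y c) +
        metricForm g e' (φ y) (fderiv ℝ (fderiv ℝ φ) y a b) (fderiv ℝ φ y c) +
        metricForm g e' (φ y) (fderiv ℝ φ y b) (fderiv ℝ (fderiv ℝ φ) y a c) := by
    intro a b c
    have h1 : fderiv ℝ (fun z => metricForm g e z b c) y a =
        fderiv ℝ (metricForm g e) y a b c := by
      rw [(((differentiableAt_metricForm g he hy.1).hasFDerivAt.clm_apply
        (hasFDerivAt_const b y)).clm_apply (hasFDerivAt_const c y)).fderiv]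
      simp
    have h2 : (fun z => metricForm g e z b c) =ᶠ[nhds y] fun z =>
        metricForm g e' (φ z) (fderiv ℝ φ z b) (fderiv ℝ φ z c) := by
      filter_upwards [isOpen_overlap.mem_nhds hy] with z hz
      exact metricForm_transition g he he' hz b c
    rw [← h1, h2.fderiv_eq]
    exact fderiv_bilinear_pullback (differentiableAt_metricForm g he' hy') hφd hT a b c
  rw [eq_comm, ← sub_eq_zero]
  refine eq_zero_of_metricForm g he' hy' ?_
  -- it is enough to test `X` against itself, written as the image of a vector `w`
  set X := fderiv ℝ φ y (connForm g e y u v) - (connForm g e' (φ y) (fderiv ℝ φ y u)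
    (fderiv ℝ φ y v) + fderiv ℝ (fderiv ℝ φ) y u v) with hX
  obtain ⟨w, hw⟩ : ∃ w, fderiv ℝ φ y w = X := by
    refine ⟨chartDeriv e (e.symm y) (chartFrame e' (e.symm y) X), ?_⟩
    rw [hφdef, fderiv_transition he he' hy, chartFrame_chartDeriv he (e.map_target hy.1),
      chartDeriv_chartFrame he' hy.2]
  have k1 := koszul g he hy.1 u v w
  have k2 := koszul g he' hy' (fderiv ℝ φ y u) (fderiv ℝ φ y v) (fderiv ℝ φ y w)
  rw [metricForm_transition g he he' hy, hderiv, hderiv, hderiv] at k1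
  have e1 := metricForm_symm (e := e') g (φ y) (fderiv ℝ φ y w) (fderiv ℝ (fderiv ℝ φ) y u v)
  have e2 := metricForm_symm (e := e') g (φ y) (fderiv ℝ φ y v) (fderiv ℝ (fderiv ℝ φ) y u w)
  rw [← hφdef, hsymm.eq w u, hsymm.eq w v, hsymm.eq v u] at k1
  have key : metricForm g e' (φ y) X (fderiv ℝ φ y w) = 0 := by
    rw [hX, map_sub, map_add, sub_apply, add_apply]
    linarith
  rwa [hw] at key

theorem riemann_antisymm (g : Metric n M) (i j k l : Fin n) (y : Eucl n) :
    riemann g e i j k l y = -riemann g e i j l k y := by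
  simp only [riemann, Finset.sum_sub_distrib]
  ring

theorem curvatureMatrix_antisymm (g : Metric n M) (a b : Fin n) (y : Eucl n) :
    curvatureMatrix g e a b y = -curvatureMatrix g e b a y := by
  ext l m
  exact riemann_antisymm g l m a b y

/-- The matrices `R_{ab}` are the components of the curvature `dω + ω ∧ ω`. -/
theorem curv_connForm (g : Metric n M) (he : e ∈ IsManifold.maximalAtlas (𝓡 n) ∞ M)
    {y : Eucl n} (hy : y ∈ e.target) (u w : Eucl n) :
    curv (connForm g e) y u w = Matrix.toEuclideanCLM (n := Fin n) (𝕜 := ℝ)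
      (∑ a, ∑ b, (u a * w b) • curvatureMatrix g e a b y) := by
  have hC : DifferentiableAt ℝ (connForm g e) y :=
    ((contDiffOn_connForm g he).contDiffAt (e.open_target.mem_nhds hy)).differentiableAt (by simp)
  -- both sides are bilinear, so `u = ∂_a` and `w = ∂_b` suffice
  refine eq_of_eq_on_basis (f := fun u => curv (connForm g e) y u w)
    (f' := fun u => Matrix.toEuclideanCLM (n := Fin n) (𝕜 := ℝ)
      (∑ a, ∑ b, (u a * w b) • curvatureMatrix g e a b y)) ⟨fun a b => ?_, fun c a => ?_⟩
    ⟨fun a b => ?_, fun c a => ?_⟩ (fun a => ?_) u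
  · ext1; simp [curv]; abel
  · ext1; simp [curv, smul_sub, smul_add]
  · simp [add_mul, add_smul, Finset.sum_add_distrib]
  · simp [mul_smul, mul_assoc, Finset.smul_sum]
  refine eq_of_eq_on_basis (f := fun w => curv (connForm g e) y (EuclideanSpace.single a 1) w)
    (f' := fun w => Matrix.toEuclideanCLM (n := Fin n) (𝕜 := ℝ)
      (∑ a', ∑ b, ((EuclideanSpace.single a (1 : ℝ)) a' * w b) • curvatureMatrix g e a' b y))
      ⟨fun a b => ?_, fun c a => ?_⟩ ⟨fun a b => ?_, fun c a => ?_⟩ (fun b => ?_) w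
  · ext1; simp [curv]; abel
  · ext1; simp [curv, smul_sub, smul_add]
  · simp [mul_add, add_smul, Finset.sum_add_distrib]
  · simp [mul_smul, Finset.smul_sum, smul_comm c]
  have hR : ∑ a', ∑ b', ((EuclideanSpace.single a (1 : ℝ)) a' *
      (EuclideanSpace.single b (1 : ℝ)) b') • curvatureMatrix g e a' b' y =
      curvatureMatrix g e a b y := by
    simp
  rw [hR]
  ext v i
  refine eq_of_eq_on_basis (f := fun v => curv (connForm g e) y (EuclideanSpace.single a 1)
      (EuclideanSpace.single b 1) v i)
    (f' := fun v => Matrix.toEuclideanCLM (n := Fin n) (𝕜 := ℝ) (curvatureMatrix g e a b y) v i)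
    ⟨fun x z => by simp, fun c x => by simp⟩ ⟨fun x z => by simp, fun c x => by simp⟩
    (fun m => ?_) v
  have hd : ∀ a b m, fderiv ℝ (connForm g e) y (EuclideanSpace.single a 1)
      (EuclideanSpace.single b 1) (EuclideanSpace.single m 1) i =
      pderiv a (christoffel g e i m b) y := by
    intro a b m
    have h1 : christoffel g e i m b = fun z => (EuclideanSpace.proj i : Eucl n →L[ℝ] ℝ)
        (connForm g e z (EuclideanSpace.single b 1) (EuclideanSpace.single m 1)) := by
      funext z
      exact (connForm_single g z i m b).symm
    have h2 := (EuclideanSpace.proj i : Eucl n →L[ℝ] ℝ).hasFDerivAt.comp y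
      ((hC.hasFDerivAt.clm_apply (hasFDerivAt_const (EuclideanSpace.single b 1) y)).clm_apply
        (hasFDerivAt_const (EuclideanSpace.single m 1) y))
    rw [pderiv, h1]
    refine Eq.trans ?_ (congrArg (fun L : Eucl n →L[ℝ] ℝ => L (EuclideanSpace.single a 1))
      h2.fderiv).symm
    simp
  have hq : ∀ a b, connForm g e y (EuclideanSpace.single a 1)
      (connForm g e y (EuclideanSpace.single b 1) (EuclideanSpace.single m 1)) i =
      ∑ h, christoffel g e h m b y * christoffel g e i h a y := by
    intro a b
    rw [connForm_apply]
    simp only [connForm_single]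
    simp [mul_comm]
  simp only [curv, add_apply, sub_apply, ContinuousLinearMap.comp_apply, PiLp.add_apply,
    PiLp.sub_apply, hd, hq, Matrix.ofLp_toEuclideanCLM]
  simp [curvatureMatrix, riemann]

end LeviCivita

/-! ### The exterior covariant derivative on the manifold -/

section Global

variable {n : ℕ} {M : Type*} [TopologicalSpace M] [ChartedSpace (Eucl n) M]
  {e e' : OpenPartialHomeomorph M (Eucl n)}

theorem TangentForm.inChart_add {p : ℕ} (α β : TangentForm n M p) :
    (α + β).inChart e = α.inChart e + β.inChart e := by
  funext y
  ext1 v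
  exact map_add (chartDeriv e (e.symm y)) _ _

theorem TangentForm.inChart_smul {p : ℕ} (c : ℝ) (α : TangentForm n M p) :
    (c • α).inChart e = c • α.inChart e := by
  funext y
  ext1 v
  exact map_smul (chartDeriv e (e.symm y)) c _

theorem ScalarForm.eq_inChart {p : ℕ} (a : ScalarForm n M p)
    (he : e ∈ IsManifold.maximalAtlas (𝓡 n) ∞ M) {x : M} (hx : x ∈ e.source) :
    a x = (a.inChart e (e x)).compContinuousLinearMap (chartDeriv e x) := by
  ext1 v
  simp only [ScalarForm.inChart]
  rw [e.left_inv hx]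
  refine congrArg (a x) (funext fun i => ?_)
  exact (chartFrame_chartDeriv he hx (v i)).symm

theorem TangentForm.eq_inChart {p : ℕ} (α : TangentForm n M p)
    (he : e ∈ IsManifold.maximalAtlas (𝓡 n) ∞ M) {x : M} (hx : x ∈ e.source) :
    α x = (chartFrame e x).compContinuousAlternatingMap
      ((α.inChart e (e x)).compContinuousLinearMap (chartDeriv e x)) := by
  ext1 v
  simp only [TangentForm.inChart]
  rw [e.left_inv hx]
  refine Eq.trans ?_ (chartFrame_chartDeriv he hx _).symm
  refine congrArg (α x) (funext fun i => ?_)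
  exact (chartFrame_chartDeriv he hx (v i)).symm

theorem TangentForm.IsSmooth.differentiableAt {p : ℕ} {α : TangentForm n M p} (hα : α.IsSmooth)
    (he : e ∈ IsManifold.maximalAtlas (𝓡 n) ∞ M) {y : Eucl n} (hy : y ∈ e.target) :
    DifferentiableAt ℝ (α.inChart e) y :=
  ((hα e he).contDiffAt (e.open_target.mem_nhds hy)).differentiableAt (by simp)

variable [IsManifold (𝓡 n) ∞ M]

theorem covDeriv_apply (g : Metric n M) {p : ℕ} (α : TangentForm n M p) (x : M) :
    covDeriv g p α x = (chartFrame (chartAt (Eucl n) x) x).compContinuousAlternatingMap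
      ((covD (connForm g (chartAt (Eucl n) x)) (α.inChart (chartAt (Eucl n) x))
        (chartAt (Eucl n) x x)).compContinuousLinearMap (chartDeriv (chartAt (Eucl n) x) x)) := by
  rw [covDeriv, covDerivLocal_eq_covD]

/-- The expression `dα + ω ∧ α` computes the covariant derivative in every chart. -/
theorem inChart_covDeriv (g : Metric n M) {p : ℕ} {α : TangentForm n M p} (hα : α.IsSmooth)
    (he : e ∈ IsManifold.maximalAtlas (𝓡 n) ∞ M) {y : Eucl n} (hy : y ∈ e.target) :
    (covDeriv g p α).inChart e y = covD (connForm g e) (α.inChart e) y := by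
  set x := e.symm y with hx
  set c := chartAt (Eucl n) x with hc
  have hcm : c ∈ IsManifold.maximalAtlas (𝓡 n) ∞ M := IsManifold.chart_mem_maximalAtlas x
  have hov : y ∈ overlap e c := ⟨hy, mem_chart_source _ x⟩
  have hφ : ContDiffAt ℝ 2 (c ∘ e.symm) y := ((contDiffOn_transition he hcm).contDiffAt
    (isOpen_overlap.mem_nhds hov)).of_le ENat.LEInfty.out
  have hrel : ∀ᶠ z in nhds y,
      (fderiv ℝ (c ∘ e.symm) z).compContinuousAlternatingMap (α.inChart e z) =
      (α.inChart c ((c ∘ e.symm) z)).compContinuousLinearMap (fderiv ℝ (c ∘ e.symm) z) := by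
    filter_upwards [isOpen_overlap.mem_nhds hov] with z hz
    exact α.inChart_transition he hcm hz
  have h := covD_change hφ (hα.differentiableAt he hy)
    (hα.differentiableAt hcm (c.map_source hov.2)) hrel
    (fun u v => connForm_transition g he hcm hov u v)
  ext1 v
  have hv := DFunLike.congr_fun h v
  change chartDeriv e x (covDeriv g p α x (chartFrame e x ∘ v)) = _
  rw [covDeriv_apply]
  change chartDeriv e x (chartFrame c x (covD (connForm g c) (α.inChart c) (c x)
    (fun i => chartDeriv c x (chartFrame e x (v i))))) = _
  have hv' : fderiv ℝ (c ∘ e.symm) y (covD (connForm g e) (α.inChart e) y v) =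
      covD (connForm g c) (α.inChart c) (c x) (fun i => chartDeriv c x (chartFrame e x (v i))) := by
    refine hv.trans ?_
    refine congrArg (covD (connForm g c) (α.inChart c) (c x)) (funext fun i => ?_)
    exact fderiv_transition he hcm hov (v i)
  rw [← hv', chartFrame_fderiv_transition he hcm hov, chartDeriv_chartFrame he (e.map_target hy)]

theorem TangentForm.IsSmooth.covDeriv (g : Metric n M) {p : ℕ} {α : TangentForm n M p}
    (hα : α.IsSmooth) : (covDeriv g p α).IsSmooth := fun e he =>
  (contDiffOn_covD e.open_target (contDiffOn_connForm g he) (hα e he)).congr fun _ hy =>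
    inChart_covDeriv g hα he hy

theorem isSmooth_iter_covDeriv (g : Metric n M) {p : ℕ} {α : TangentForm n M p}
    (hα : α.IsSmooth) (N : ℕ) : (iter (covDeriv g) N α).IsSmooth := by
  induction N with
  | zero => exact hα
  | succ N ih => exact TangentForm.IsSmooth.covDeriv g ih

theorem inChart_iter_covDeriv (g : Metric n M) {p : ℕ} {α : TangentForm n M p}
    (hα : α.IsSmooth) (he : e ∈ IsManifold.maximalAtlas (𝓡 n) ∞ M) (N : ℕ) {y : Eucl n}
    (hy : y ∈ e.target) :
    (iter (covDeriv g) N α).inChart e y = covIter (connForm g e) (α.inChart e) N y := by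
  induction N generalizing y with
  | zero => rfl
  | succ N ih =>
    refine (inChart_covDeriv g (isSmooth_iter_covDeriv g hα N) he hy).trans ?_
    refine Filter.EventuallyEq.covD_eq ?_
    filter_upwards [e.open_target.mem_nhds hy] with z hz
    exact ih hz

theorem inChart_iter_covDeriv_two_mul (g : Metric n M) {p : ℕ} {α : TangentForm n M p}
    (hα : α.IsSmooth) (he : e ∈ IsManifold.maximalAtlas (𝓡 n) ∞ M) (k : ℕ) {y : Eucl n}
    (hy : y ∈ e.target) (v : Fin (p + 2 * k) → Eucl n) :
    (iter (covDeriv g) (2 * k) α).inChart e y v = ((2 : ℝ) ^ k * p.factorial)⁻¹ •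
      antisymm (curvPow (curv (connForm g e) y) (α.inChart e y) k) v := by
  rw [inChart_iter_covDeriv g hα he (2 * k) hy]
  exact covIter_two_mul e.open_target (contDiffOn_connForm g he) (hα e he) k hy v

theorem covDeriv_wedge (g : Metric n M) {p q r : ℕ} (h : p + q = r) {a : ScalarForm n M p}
    {α : TangentForm n M q} (ha : a.IsSmooth) (hα : α.IsSmooth) :
    covDeriv g r (a.wedge h α) = a.d.wedge (show (p + 1) + q = r + 1 by omega) α +
      (-1 : ℝ) ^ p • a.wedge (show p + (q + 1) = r + 1 by omega) (covDeriv g q α) := by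
  funext x
  set c := chartAt (Eucl n) x with hc
  have hcm : c ∈ IsManifold.maximalAtlas (𝓡 n) ∞ M := IsManifold.chart_mem_maximalAtlas x
  have hx : x ∈ c.source := mem_chart_source _ x
  have hw : (a.wedge h α).inChart c =
      fun z => RiemannianForms.wedge h (a.inChart c z) (α.inChart c z) :=
    funext fun z => ScalarForm.inChart_wedge h a α z
  have had : DifferentiableAt ℝ (a.inChart c) (c x) :=
    ((ha c hcm).contDiffAt (c.open_target.mem_nhds (c.map_source hx))).differentiableAt (by simp)
  have key := covD_wedge h (connForm g c) had (hα.differentiableAt hcm (c.map_source hx))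
  rw [covDeriv_apply, ← hc, hw, key]
  have h1 : (a.d.wedge (show (p + 1) + q = r + 1 by omega) α) x =
      RiemannianForms.wedge (show (p + 1) + q = r + 1 by omega)
      ((extDeriv (a.inChart c) (c x)).compContinuousLinearMap (chartDeriv c x))
      ((chartFrame c x).compContinuousAlternatingMap
        ((α.inChart c (c x)).compContinuousLinearMap (chartDeriv c x))) := by
    rw [← α.eq_inChart hcm hx]
    rfl
  have h2 : (a.wedge (show p + (q + 1) = r + 1 by omega) (covDeriv g q α)) x =
      RiemannianForms.wedge (show p + (q + 1) = r + 1 by omega)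
      ((a.inChart c (c x)).compContinuousLinearMap (chartDeriv c x))
      ((chartFrame c x).compContinuousAlternatingMap
        ((covD (connForm g c) (α.inChart c) (c x)).compContinuousLinearMap (chartDeriv c x))) := by
    rw [← a.eq_inChart hcm hx, ← covDeriv_apply]
    rfl
  have w1 := wedge_comp (V := Eucl n) (V' := Eucl n) (W := Eucl n) (W' := Eucl n)
    (show (p + 1) + q = r + 1 by omega) (extDeriv (a.inChart c) (c x)) (α.inChart c (c x))
    (chartDeriv c x) (chartFrame c x)
  have w2 := wedge_comp (V := Eucl n) (V' := Eucl n) (W := Eucl n) (W' := Eucl n)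
    (show p + (q + 1) = r + 1 by omega) (a.inChart c (c x))
    (covD (connForm g c) (α.inChart c) (c x)) (chartDeriv c x) (chartFrame c x)
  have h3 : (a.d.wedge (show (p + 1) + q = r + 1 by omega) α +
      (-1 : ℝ) ^ p • a.wedge (show p + (q + 1) = r + 1 by omega) (covDeriv g q α)) x =
      (a.d.wedge (show (p + 1) + q = r + 1 by omega) α) x + (-1 : ℝ) ^ p •
        (a.wedge (show p + (q + 1) = r + 1 by omega) (covDeriv g q α)) x := rfl
  rw [h3, h1, h2]
  ext1 v
  have w1v := DFunLike.congr_fun w1 v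
  have w2v := DFunLike.congr_fun w2 v
  refine Eq.trans ?_ (congrArg₂ (fun s t : Eucl n => s + (-1 : ℝ) ^ p • t) w1v w2v)
  exact (map_add (chartFrame c x) _ _).trans
    (congrArg _ (map_smul (chartFrame c x) ((-1 : ℝ) ^ p) _))

theorem covDeriv_add (g : Metric n M) {p : ℕ} {α β : TangentForm n M p} (hα : α.IsSmooth)
    (hβ : β.IsSmooth) : covDeriv g p (α + β) = covDeriv g p α + covDeriv g p β := by
  funext x
  have hcm := IsManifold.chart_mem_maximalAtlas (I := 𝓡 n) (n := ∞) (M := M) x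
  have hx := mem_chart_target (Eucl n) x
  rw [covDeriv_apply, TangentForm.inChart_add,
    covD_add (hα.differentiableAt hcm hx) (hβ.differentiableAt hcm hx)]
  refine Eq.trans ?_ (congrArg₂ (· + ·) (covDeriv_apply g α x) (covDeriv_apply g β x)).symm
  ext1 v
  exact map_add (chartFrame (chartAt (Eucl n) x) x) _ _

theorem covDeriv_smul (g : Metric n M) {p : ℕ} (c : ℝ) (α : TangentForm n M p) :
    covDeriv g p (c • α) = c • covDeriv g p α := by
  funext x
  rw [covDeriv_apply, TangentForm.inChart_smul, covD_smul]
  refine Eq.trans ?_ (congrArg (c • ·) (covDeriv_apply g α x)).symm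
  ext1 v
  exact map_smul (chartFrame (chartAt (Eucl n) x) x) c _

/-- The pairing sums of the matrices `R_{ab}` at a point vanish if and only if the `k`-th power of
the curvature form vanishes there. -/
theorem antisymm_curv_eq_zero_iff (g : Metric n M) (he : e ∈ IsManifold.maximalAtlas (𝓡 n) ∞ M)
    (k : ℕ) {y : Eucl n} (hy : y ∈ e.target) :
    (∀ w, antisymm (pairProd (k := k) (curv (connForm g e) y)) w = 0) ↔
      ∀ (A : Finset (Fin n)) (hA : A.card = 2 * k),
        pairingSum (fun a b => curvatureMatrix g e a b y) A hA = 0 := by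
  rw [← antisymm_pairProd_sum_eq_zero_iff fun a b => curvatureMatrix_antisymm g a b y]
  have h : ∀ w : Fin (2 * k) → Eucl n, antisymm (pairProd (k := k) (curv (connForm g e) y)) w =
      Matrix.toEuclideanCLM (n := Fin n) (𝕜 := ℝ) (antisymm (pairProd (k := k)
        fun u v : Fin n → ℝ => ∑ a, ∑ b, (u a * v b) • curvatureMatrix g e a b y)
          (fun i => w i)) := by
    intro w
    rw [show curv (connForm g e) y = _ from
      funext fun u => funext fun v => curv_connForm g he hy u v]
    refine Eq.trans ?_ (antisymm_map ((Matrix.toEuclideanCLM (n := Fin n) (𝕜 := ℝ) :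
      Matrix (Fin n) (Fin n) ℝ →+ (Eucl n →L[ℝ] Eucl n))) _ _)
    refine Finset.sum_congr rfl fun σ _ => ?_
    congr 1
    exact (map_pairProd ((Matrix.toEuclideanCLM (n := Fin n) (𝕜 := ℝ) :
      Matrix (Fin n) (Fin n) ℝ →* (Eucl n →L[ℝ] Eucl n))) _ _).symm
  constructor
  · intro h0 w
    have := h fun i => WithLp.toLp 2 (w i)
    rw [h0] at this
    exact (map_eq_zero_iff _ Matrix.toEuclideanCLM.injective).1 this.symm
  · intro h0 w
    rw [h, h0, map_zero]

/-- Every tangent vector at a point is the value of a smooth vector field. -/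
theorem exists_isSmooth_inChart_eq [T2Space M] (he : e ∈ IsManifold.maximalAtlas (𝓡 n) ∞ M)
    {y : Eucl n} (hy : y ∈ e.target) (u : Eucl n) :
    ∃ α : TangentForm n M 0, α.IsSmooth ∧ ∀ v, α.inChart e y v = u := by
  obtain ⟨f, -, hf⟩ := (SmoothBumpFunction.nhds_basis_tsupport (I := 𝓡 n) (e.symm y)).mem_iff.1
    (e.open_source.mem_nhds (e.map_target hy))
  refine ⟨fun x => ContinuousAlternatingMap.constOfIsEmpty ℝ _ (Fin 0)
    (f x • chartFrame e x u), fun e' he' z hz => ContDiffAt.contDiffWithinAt ?_, fun v => ?_⟩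
  · have hin : ∀ z, TangentForm.inChart e' (fun x => ContinuousAlternatingMap.constOfIsEmpty ℝ _
        (Fin 0) (f x • chartFrame e x u)) z =
        ContinuousAlternatingMap.constOfIsEmptyLIE ℝ (Eucl n) (Eucl n) (Fin 0)
        (f (e'.symm z) • chartDeriv e' (e'.symm z) (chartFrame e (e'.symm z) u)) := by
      intro z
      ext1 v
      exact map_smul (chartDeriv e' (e'.symm z)) _ _
    rw [show TangentForm.inChart e' (fun x => ContinuousAlternatingMap.constOfIsEmpty ℝ _
        (Fin 0) (f x • chartFrame e x u)) = _ from funext hin]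
    refine (LinearIsometryEquiv.contDiff _).contDiffAt.comp z ?_
    -- near points outside the chart domain of `e`, where `chartFrame e` is meaningless, `f` is zero
    by_cases hzs : e'.symm z ∈ e.source
    · have hov : z ∈ overlap e' e := ⟨hz, hzs⟩
      have hfs : ContDiffAt ℝ ∞ (fun z => f (e'.symm z)) z := by
        rw [← contMDiffAt_iff_contDiffAt]
        exact f.contMDiff.contMDiffAt.comp z
          ((contMDiffOn_symm_of_mem_maximalAtlas he').contMDiffAt (e'.open_target.mem_nhds hz))
      have hz' : (e ∘ e'.symm) z ∈ overlap e e' :=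
        ⟨e.map_source hzs, by
          change e.symm (e (e'.symm z)) ∈ e'.source
          rw [e.left_inv hzs]
          exact e'.map_target hz⟩
      have hT : ContDiffAt ℝ ∞ (fun z => fderiv ℝ (e' ∘ e.symm) ((e ∘ e'.symm) z) u) z := by
        have h1 : ContDiffAt ℝ ∞ (fderiv ℝ (e' ∘ e.symm)) ((e ∘ e'.symm) z) :=
          ((contDiffOn_transition he he').contDiffAt
            (isOpen_overlap.mem_nhds hz')).fderiv_right (by simp)
        exact (h1.comp z ((contDiffOn_transition he' he).contDiffAt
          (isOpen_overlap.mem_nhds hov))).clm_apply contDiffAt_const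
      refine (hfs.smul hT).congr_of_eventuallyEq ?_
      filter_upwards [isOpen_overlap.mem_nhds hov] with z hz
      have hz' : (e ∘ e'.symm) z ∈ overlap e e' :=
        ⟨e.map_source hz.2, by
          change e.symm (e (e'.symm z)) ∈ e'.source
          rw [e.left_inv hz.2]
          exact e'.map_target hz.1⟩
      have hs : e.symm ((e ∘ e'.symm) z) = e'.symm z := e.left_inv hz.2
      change _ = f (e'.symm z) • fderiv ℝ (e' ∘ e.symm) ((e ∘ e'.symm) z) u
      rw [fderiv_transition he he' hz', hs]
    · have h0 : ∀ᶠ x in nhds (e'.symm z), f x = 0 := by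
        filter_upwards [(isClosed_tsupport f).isOpen_compl.mem_nhds fun h => hzs (hf h)] with x hx
        exact image_eq_zero_of_notMem_tsupport hx
      have h1 : (fun z => f (e'.symm z) •
          chartDeriv e' (e'.symm z) (chartFrame e (e'.symm z) u)) =ᶠ[nhds z]
          fun _ => (0 : Eucl n) := by
        filter_upwards [(e'.continuousAt_symm hz).eventually h0] with w hw
        rw [hw, zero_smul]
      exact contDiffAt_const.congr_of_eventuallyEq h1
  · have : f (e.symm y) = 1 := f.eq_one
    change chartDeriv e (e.symm y) (f (e.symm y) • chartFrame e (e.symm y) u) = u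
    rw [this, one_smul, chartDeriv_chartFrame he (e.map_target hy)]

end Global
end RiemannianForms

end

theorem theorem9 {n : ℕ} {M : Type*} [TopologicalSpace M] [T2Space M]
    [ChartedSpace (EuclideanSpace ℝ (Fin n)) M] [IsManifold (𝓡 n) ∞ M]
    (g : Bundle.ContMDiffRiemannianMetric (𝓡 n) ∞ (EuclideanSpace ℝ (Fin n))
      (fun x : M => TangentSpace (𝓡 n) x))
    (k : ℕ) (hk : 1 ≤ k)
    (𝒞 : Set (OpenPartialHomeomorph M (EuclideanSpace ℝ (Fin n))))
    (h𝒞 : 𝒞 ⊆ IsManifold.maximalAtlas (𝓡 n) ∞ M)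
    (hcover : ∀ x : M, ∃ e ∈ 𝒞, x ∈ e.source) :
    RiemannianForms.IsNDG (2 * k) (RiemannianForms.covDeriv g) ↔
      ∀ e ∈ 𝒞, ∀ y ∈ e.target, ∀ (A : Finset (Fin n)) (hA : A.card = 2 * k),
        ∀ l m : Fin n,
          RiemannianForms.pairingSum
            (fun a b => RiemannianForms.curvatureMatrix g e a b y) A hA l m = 0 := by
  open RiemannianForms in
  have hmat : ∀ (e : OpenPartialHomeomorph M (EuclideanSpace ℝ (Fin n))) (y),
      (∀ (A : Finset (Fin n)) (hA : A.card = 2 * k), ∀ l m : Fin n,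
        pairingSum (fun a b => curvatureMatrix g e a b y) A hA l m = 0) ↔
      ∀ (A : Finset (Fin n)) (hA : A.card = 2 * k),
        pairingSum (fun a b => curvatureMatrix g e a b y) A hA = 0 := fun e y =>
    forall₂_congr fun A hA => ⟨fun h => Matrix.ext h, fun h l m => by rw [h]; rfl⟩
  constructor
  · intro hN e he y hy
    rw [hmat, ← RiemannianForms.antisymm_curv_eq_zero_iff g (h𝒞 he) k hy]
    refine RiemannianForms.antisymm_pairProd_eq_zero_of_curvPow fun u v => ?_
    -- apply `∇^{2k} = 0` to a vector field with the value `u` at the point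
    obtain ⟨α, hα, hαu⟩ := RiemannianForms.exists_isSmooth_inChart_eq (h𝒞 he) hy u
    have h1 := RiemannianForms.inChart_iter_covDeriv_two_mul g hα (h𝒞 he) k hy v
    rw [hN.nilpotent 0 α hα, show (α.inChart e y : _ → _) = fun _ => u from funext hαu] at h1
    have h2 := (smul_eq_zero.1 (h1.symm.trans (map_zero (RiemannianForms.chartDeriv e _))))
    exact h2.resolve_left (by positivity)
  · intro h
    refine ⟨fun p α hα => RiemannianForms.TangentForm.IsSmooth.covDeriv g hα,
      fun p α β hα hβ => RiemannianForms.covDeriv_add g hα hβ,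
      fun p c α _ => RiemannianForms.covDeriv_smul g c α,
      fun p q r hr a α ha hα => RiemannianForms.covDeriv_wedge g hr ha hα, fun p α hα => ?_⟩
    funext x
    obtain ⟨e, he, hx⟩ := hcover x
    have hy := e.map_source hx
    have h0 := (RiemannianForms.antisymm_curv_eq_zero_iff g (h𝒞 he) k hy).2
      ((hmat e (e x)).1 (h e he _ hy))
    have hz : (RiemannianForms.iter (RiemannianForms.covDeriv g) (2 * k) α).inChart e (e x) =
        0 := by
      ext1 w
      rw [RiemannianForms.inChart_iter_covDeriv_two_mul g hα (h𝒞 he) k hy w,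
        RiemannianForms.antisymm_curvPow_eq_zero h0, smul_zero]
      rfl
    refine (RiemannianForms.TangentForm.eq_inChart
      (RiemannianForms.iter (RiemannianForms.covDeriv g) (2 * k) α) (h𝒞 he) hx).trans ?_
    rw [hz]
    ext1 v
    exact map_zero (RiemannianForms.chartFrame e x)
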